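/- There is an absolute constant $C>0$ such that the following holds for every dimension $d$. Let $W=(W(t))_{t\ge 0}$ be a standard $d$-dimensional Brownian motion with $W(0)=0$, and let $g:[0,1]\times\mathbb{R}^d\to\mathbb{R}$ be a Borel function with $|g(s,z)|\le 1$ for all $(s,z)\in[0,1]\times\mathbb{R}^d$. Then for every even positive integer $p$ and every $x\in\mathbb{R}^d$, $$\mathbb{E}\left(\int_0^1\{g(t,W(t)+x)-g(t,W(t))\}\,dt\right)^p\le C^p\,(p/2)!\,|x|^p ,$$ where $|x|$ is the Euclidean norm; in particular, the integral over $[0,1]$ exists almost surely and its $p$-th power is integrable. The constant $C$ depends on none of $d$, $g$, $p$, $x$. -/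

import Mathlib

open MeasureTheory ProbabilityTheory
open scoped NNReal Nat

/-- `W` is a standard `d`-dimensional Brownian motion (started at the origin) under `P`: its
coordinate processes are independent standard one-dimensional Brownian motions.
(`IsBrownianReal` prescribes the centred Gaussian finite-dimensional laws with covariance
`min s t`, hence `W 0 = 0` almost surely, and almost surely continuous paths; independence is that
of the whole processes `fun ω t ↦ W t ω i`.) -/
structure IsStandardBrownianMotion {d : ℕ} {Ω : Type*} [MeasurableSpace Ω]
    (W : ℝ≥0 → Ω → EuclideanSpace ℝ (Fin d)) (P : Measure Ω) : Prop where
  isBrownianReal_coord : ∀ i : Fin d, IsBrownianReal (fun t ω ↦ W t ω i) P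
  iIndepFun_coord : iIndepFun (fun (i : Fin d) (ω : Ω) (t : ℝ≥0) ↦ W t ω i) P

/-!
The proof replaces stochastic calculus by a discrete form of the Lyons-Zheng decomposition into
forward and backward martingales.

Let `e = x / ‖x‖` and let `f (t, ·)` be the primitive of `g (t, · + x) - g (t, ·)` along `e` given
by `segmentIntegral`; it is bounded by `‖x‖`, whatever the regularity of `g`. The integral of
`∂ₑ f (t, W t) = g (t, W t + x) - g (t, W t)` is the quadratic covariation of `f (t, W t)` and
`⟪W t, e⟫`, that is, the limit of
`∑ (f (t_k, W t_k + Δ_k e) - f (t_k, W t_k)) Δ_k`, where `Δ_k = ⟪W t_{k+1} - W t_k, e⟫` and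
`t_k = k / n` (`gridCovariation`). Such sums have moments controlled by the supremum of `f` alone
(`gridCovariation_eq`, `IsRegularBrownian.integral_gridCovariation_pow_le`):

* `∑ f (t_k, W t_k) Δ_k` is a martingale transform in the forward direction, hence sub-Gaussian;
* given the component of `W` along `e` from time `t_{k+1}` on, and the orthogonal components at all
  times, `Δ_k` is the sum of the drift `⟪W t_{k+1}, e⟫ / (k + 1)` and an independent centred
  Gaussian of variance at most `1 / n`. The latter gives a martingale transform in the backward
  direction, again sub-Gaussian;
* the drift is dominated by a Riemann sum of `∫ |⟪W t, e⟫| / t`, whose `L^p` norm is at most that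
  of a normal variable times `∫ t ^ (-1/2) = 2`.

Both martingale bounds come from `hasSubgaussianMGF_sum_mul`, and a sub-Gaussian variable has even
moments of order `C ^ p (p / 2)!`. For continuous compactly supported `g` the sums converge in `L¹`
to the integral (`IsRegularBrownian.integral_abs_gridCovariation_sub_le`, `tendsto_riemann_sum`).
Since the bound does not depend on the continuity of `g`, it passes to Borel `g` by density of
continuous functions in `L¹` of the occupation measure (`IsRegularBrownian.integral_pow_le`). As all
integrals are bounded by `2`, convergence in `L¹` suffices in both limits (`integral_pow_le_add`).
-/

/-! ### Sub-Gaussian martingale transforms -/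

section Subgaussian

variable {Ω : Type*} [MeasurableSpace Ω] {P : Measure Ω}

lemma hasSubgaussianMGF_of_lintegral_le {X : Ω → ℝ} {c : ℝ≥0} (hX : Measurable X)
    (h : ∀ t : ℝ, ∫⁻ ω, ENNReal.ofReal (Real.exp (t * X ω)) ∂P
      ≤ ENNReal.ofReal (Real.exp (c * t ^ 2 / 2))) :
    HasSubgaussianMGF X c P := by
  have hm (t : ℝ) : Measurable fun ω ↦ Real.exp (t * X ω) := by fun_prop
  refine ⟨fun t ↦ ⟨(hm t).aestronglyMeasurable, ?_⟩, fun t ↦ ?_⟩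
  · rw [hasFiniteIntegral_iff_ofReal (.of_forall fun ω ↦ (Real.exp_pos _).le)]
    exact (h t).trans_lt ENNReal.ofReal_lt_top
  · rw [mgf, integral_eq_lintegral_of_nonneg_ae (.of_forall fun ω ↦ (Real.exp_pos _).le)
      (hm t).aestronglyMeasurable]
    exact ENNReal.toReal_le_of_le_ofReal (Real.exp_pos _).le (h t)

lemma ProbabilityTheory.HasSubgaussianMGF.lintegral_le {X : Ω → ℝ} {c : ℝ≥0}
    (h : HasSubgaussianMGF X c P) (t : ℝ) :
    ∫⁻ ω, ENNReal.ofReal (Real.exp (t * X ω)) ∂P ≤ ENNReal.ofReal (Real.exp (c * t ^ 2 / 2)) := by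
  rw [← ofReal_integral_eq_lintegral_ofReal (h.integrable_exp_mul t)
    (.of_forall fun ω ↦ (Real.exp_pos _).le)]
  exact ENNReal.ofReal_le_ofReal (h.mgf_le t)

lemma hasSubgaussianMGF_of_hasLaw_gaussianReal {X : Ω → ℝ} {v : ℝ≥0}
    (h : HasLaw X (gaussianReal 0 v) P) : HasSubgaussianMGF X v P := by
  refine ⟨fun t ↦ ?_, fun t ↦ ?_⟩
  · exact (h.map_eq ▸ integrable_exp_mul_gaussianReal t :
      Integrable (fun x ↦ Real.exp (t * x)) (P.map X)).comp_aemeasurable h.aemeasurable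
  · rw [mgf_gaussianReal h.map_eq]
    simp

/-- One step of a martingale transform: `ξ` is independent of the past `(X, u)`, and integrating it
out first costs a factor at most `exp (a² v t² / 2)`. -/
lemma hasSubgaussianMGF_add_mul [IsProbabilityMeasure P] {X u ξ : Ω → ℝ} {a c v : ℝ≥0}
    (mX : Measurable X) (mu : Measurable u) (mξ : Measurable ξ)
    (hX : HasSubgaussianMGF X c P) (hξ : HasSubgaussianMGF ξ v P) (hu : ∀ ω, |u ω| ≤ a)
    (hind : IndepFun (fun ω ↦ (X ω, u ω)) ξ P) :
    HasSubgaussianMGF (fun ω ↦ X ω + u ω * ξ ω) (c + a ^ 2 * v) P := by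
  refine hasSubgaussianMGF_of_lintegral_le (by fun_prop) fun t ↦ ?_
  have mY : Measurable fun ω ↦ (X ω, u ω) := by fun_prop
  have hlaw := (indepFun_iff_map_prod_eq_prod_map_map mY.aemeasurable mξ.aemeasurable).1 hind
  let F : (ℝ × ℝ) × ℝ → ENNReal := fun q ↦
    ENNReal.ofReal (Real.exp (t * q.1.1)) * ENNReal.ofReal (Real.exp (t * q.1.2 * q.2))
  have mF : Measurable F := by fun_prop
  have : IsProbabilityMeasure (P.map ξ) := Measure.isProbabilityMeasure_map mξ.aemeasurable
  calc ∫⁻ ω, ENNReal.ofReal (Real.exp (t * (X ω + u ω * ξ ω))) ∂P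
      = ∫⁻ ω, F ((X ω, u ω), ξ ω) ∂P := by
        refine lintegral_congr fun ω ↦ ?_
        simp only [F]
        rw [← ENNReal.ofReal_mul (Real.exp_pos _).le, ← Real.exp_add]
        ring_nf
    _ = ∫⁻ q, F q ∂(P.map fun ω ↦ ((X ω, u ω), ξ ω)) :=
        (lintegral_map mF (by fun_prop)).symm
    _ = ∫⁻ ω, ∫⁻ ω', F ((X ω, u ω), ξ ω') ∂P ∂P := by
        rw [hlaw, lintegral_prod _ mF.aemeasurable,
          lintegral_map (f := fun y ↦ ∫⁻ z, F (y, z) ∂P.map ξ) mF.lintegral_prod_right' mY]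
        refine lintegral_congr fun ω ↦ ?_
        rw [lintegral_map (by fun_prop) mξ]
    _ ≤ ∫⁻ ω, ENNReal.ofReal (Real.exp (t * X ω)) *
          ENNReal.ofReal (Real.exp (a ^ 2 * v * t ^ 2 / 2)) ∂P := by
        refine lintegral_mono fun ω ↦ ?_
        simp only [F]
        rw [lintegral_const_mul _ (by fun_prop)]
        refine mul_le_mul_right ((hξ.lintegral_le (t * u ω)).trans
          (ENNReal.ofReal_le_ofReal (Real.exp_le_exp.2 ?_))) _
        have h1 : u ω ^ 2 ≤ (a : ℝ) ^ 2 := sq_le_sq' (abs_le.1 (hu ω)).1 (abs_le.1 (hu ω)).2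
        have h2 : (v : ℝ) * t ^ 2 * u ω ^ 2 ≤ v * t ^ 2 * (a : ℝ) ^ 2 := by gcongr
        linarith
    _ ≤ ENNReal.ofReal (Real.exp (c * t ^ 2 / 2)) *
          ENNReal.ofReal (Real.exp (a ^ 2 * v * t ^ 2 / 2)) := by
        rw [lintegral_mul_const _ (by fun_prop)]
        exact mul_le_mul_left (hX.lintegral_le t) _
    _ = ENNReal.ofReal (Real.exp ((c + a ^ 2 * v : ℝ≥0) * t ^ 2 / 2)) := by
        rw [← ENNReal.ofReal_mul (Real.exp_pos _).le, ← Real.exp_add]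
        push_cast
        ring_nf

/-- Martingale transforms of sub-Gaussian increments by bounded predictable weights are
sub-Gaussian. Here `𝓕 k` is the information available before the increment `ξ k` is revealed. -/
lemma hasSubgaussianMGF_sum_mul [IsProbabilityMeasure P] {u ξ : ℕ → Ω → ℝ} {a v : ℝ≥0} {n : ℕ}
    (𝓕 : ℕ → MeasurableSpace Ω) (h𝓕 : ∀ k < n, 𝓕 k ≤ ‹MeasurableSpace Ω›)
    (mu : ∀ k < n, Measurable[𝓕 k] (u k))
    (mpast : ∀ k < n, ∀ j < k, Measurable[𝓕 k] (fun ω ↦ u j ω * ξ j ω))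
    (mξ : ∀ k < n, Measurable (ξ k)) (hξ : ∀ k < n, HasSubgaussianMGF (ξ k) v P)
    (hu : ∀ k < n, ∀ ω, |u k ω| ≤ a)
    (hind : ∀ k < n, Indep (𝓕 k) (MeasurableSpace.comap (ξ k) inferInstance) P) :
    HasSubgaussianMGF (fun ω ↦ ∑ k ∈ Finset.range n, u k ω * ξ k ω) (n * (a ^ 2 * v)) P := by
  suffices ∀ m ≤ n, HasSubgaussianMGF (fun ω ↦ ∑ k ∈ Finset.range m, u k ω * ξ k ω)
      (m * (a ^ 2 * v)) P from this n le_rfl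
  intro m
  induction m with
  | zero => simp
  | succ m ih =>
    intro hm
    have hm' : m < n := hm
    have mX : Measurable[𝓕 m] fun ω ↦ ∑ k ∈ Finset.range m, u k ω * ξ k ω := by
      have := fun k (hk : k ∈ Finset.range m) ↦ mpast m hm' k (Finset.mem_range.1 hk)
      exact Finset.measurable_fun_sum _ this
    have hpair : Measurable[𝓕 m]
        fun ω ↦ (∑ k ∈ Finset.range m, u k ω * ξ k ω, u m ω) :=
      mX.prodMk (mu m hm')
    have := hasSubgaussianMGF_add_mul (mX.mono (h𝓕 m hm') le_rfl)
      ((mu m hm').mono (h𝓕 m hm') le_rfl) (mξ m hm') (ih hm'.le) (hξ m hm') (hu m hm')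
      ((IndepFun_iff_Indep _ _ _).2 (indep_of_indep_of_le_left (hind m hm') hpair.comap_le))
    simp_rw [Finset.sum_range_succ]
    convert this using 1
    push_cast
    ring

lemma ProbabilityTheory.HasSubgaussianMGF.mono {X : Ω → ℝ} {c c' : ℝ≥0}
    (h : HasSubgaussianMGF X c P) (hc : c ≤ c') : HasSubgaussianMGF X c' P :=
  ⟨h.integrable_exp_mul, fun t ↦ (h.mgf_le t).trans (Real.exp_le_exp.2 (by gcongr))⟩

lemma ProbabilityTheory.HasSubgaussianMGF.integrable_pow [IsFiniteMeasure P] {X : Ω → ℝ} {c : ℝ≥0}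
    (h : HasSubgaussianMGF X c P) (p : ℕ) : Integrable (fun ω ↦ X ω ^ p) P := by
  have h1 : MemLp X p P := by exact_mod_cast h.memLp p
  have := h1.integrable_norm_pow'
  refine (integrable_norm_iff (h.aemeasurable.pow_const p).aestronglyMeasurable).1 ?_
  simpa using this

/-- Even moments of a sub-Gaussian variable, from `y ^ (2m) / (2m)! ≤ exp y + exp (-y)` at
`y = t X` with the optimal choice `c t² = 2m`. -/
lemma ProbabilityTheory.HasSubgaussianMGF.integral_pow_le [IsProbabilityMeasure P]
    {X : Ω → ℝ} {c : ℝ≥0} (h : HasSubgaussianMGF X c P) (hc : 0 < c) {m : ℕ} (hm : 0 < m) :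
    ∫ ω, X ω ^ (2 * m) ∂P ≤ (16 * c) ^ m * m ! := by
  have hc' : (0 : ℝ) < c := by exact_mod_cast hc
  have hmr : (0 : ℝ) < m := by exact_mod_cast hm
  set t : ℝ := √(2 * m / c) with ht
  have ht2 : t ^ 2 = 2 * m / c := Real.sq_sqrt (by positivity)
  have key (y : ℝ) : y ^ (2 * m) ≤ (2 * m)! * (Real.exp y + Real.exp (-y)) := by
    have h1 := Real.pow_div_factorial_le_exp |y| (abs_nonneg y) (2 * m)
    rw [Even.pow_abs (even_two_mul m), div_le_iff₀ (by positivity), mul_comm (Real.exp _)] at h1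
    refine h1.trans ?_
    gcongr
    rcases abs_cases y with ⟨h2, -⟩ | ⟨h2, -⟩ <;> rw [h2] <;>
      linarith [Real.exp_pos y, Real.exp_pos (-y)]
  have hint := h.integrable_exp_mul
  have h1 : t ^ (2 * m) * ∫ ω, X ω ^ (2 * m) ∂P
      ≤ (2 * m)! * (Real.exp m + Real.exp m) := by
    rw [← integral_const_mul]
    calc ∫ ω, t ^ (2 * m) * X ω ^ (2 * m) ∂P
        ≤ ∫ ω, (2 * m)! * (Real.exp (t * X ω) + Real.exp (-t * X ω)) ∂P := by
          refine integral_mono ((h.integrable_pow _).const_mul _)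
            (((hint t).add (hint (-t))).const_mul _) fun ω ↦ ?_
          simpa [mul_pow] using key (t * X ω)
      _ = (2 * m)! * (mgf X P t + mgf X P (-t)) := by
          rw [integral_const_mul, integral_add (hint t) (hint (-t))]; rfl
      _ ≤ _ := by
          have e1 : (c : ℝ) * t ^ 2 / 2 = m := by rw [ht2]; field_simp
          have e2 := h.mgf_le t
          have e3 := h.mgf_le (-t)
          rw [neg_sq, e1] at e3
          rw [e1] at e2
          gcongr
  -- `(2m)! ≤ 4 ^ m (m!)²` and `m! ≤ m ^ m`
  have h2 : ((2 * m)! : ℝ) ≤ 4 ^ m * m ! * m ^ m := by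
    have e1 : (2 * m)! = m.centralBinom * m ! * m ! := by
      rw [Nat.centralBinom_eq_two_mul_choose]
      have := Nat.choose_mul_factorial_mul_factorial (show m ≤ 2 * m by omega)
      rw [← this]; congr; omega
    have e2 : m.centralBinom ≤ 4 ^ m := by
      rw [Nat.centralBinom_eq_two_mul_choose]
      calc (2 * m).choose m ≤ 2 ^ (2 * m) := Nat.choose_le_two_pow _ _
        _ = 4 ^ m := by rw [pow_mul]; norm_num
    rw [e1]
    exact_mod_cast Nat.mul_le_mul (Nat.mul_le_mul e2 le_rfl) (Nat.factorial_le_pow m)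
  have h3 : Real.exp m + Real.exp m ≤ 8 ^ m := by
    have e1 : Real.exp m ≤ 4 ^ m := by
      rw [← mul_one (m : ℝ), Real.exp_nat_mul]
      have := Real.exp_one_lt_d9
      gcongr
      linarith
    have e2 : (2 : ℝ) ≤ 2 ^ m := by simpa using pow_le_pow_right₀ (by norm_num : (1 : ℝ) ≤ 2) hm
    have e3 : (8 : ℝ) ^ m = 2 ^ m * 4 ^ m := by rw [← mul_pow]; norm_num
    rw [e3]
    nlinarith [Real.exp_pos m, pow_pos (by norm_num : (0 : ℝ) < 4) m]
  have h4 : t ^ (2 * m) * ((16 * c) ^ m * m ! : ℝ) = (4 ^ m * m ! * m ^ m) * 8 ^ m := by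
    rw [pow_mul, ht2, ← mul_assoc, ← mul_pow]
    have : 2 * (m : ℝ) / c * (16 * c) = 4 * m * 8 := by field_simp; norm_num
    rw [this, mul_pow, mul_pow]
    ring
  have htpos : 0 < t ^ (2 * m) := by rw [pow_mul, ht2]; positivity
  refine le_of_mul_le_mul_left (h1.trans ?_) htpos
  rw [h4]
  gcongr

end Subgaussian

/-! ### Brownian motion in a Euclidean space -/

section Brownian

open scoped RealInnerProductSpace

variable {E Ω : Type*} [NormedAddCommGroup E] [InnerProductSpace ℝ E]

/-- The σ-algebra generated by the functionals `⟪W t, v⟫` with `(t, v) ∈ S`. -/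
@[reducible]
def sigmaInner (W : ℝ≥0 → Ω → E) (S : Set (ℝ≥0 × E)) : MeasurableSpace Ω :=
  MeasurableSpace.comap (fun ω (q : S) ↦ ⟪W q.1.1 ω, q.1.2⟫) inferInstance

lemma measurable_inner_sigmaInner (W : ℝ≥0 → Ω → E) {S : Set (ℝ≥0 × E)} {t : ℝ≥0} {v : E}
    (h : (t, v) ∈ S) : Measurable[sigmaInner W S] fun ω ↦ ⟪W t ω, v⟫ :=
  (measurable_pi_apply (⟨(t, v), h⟩ : S)).comp
    (comap_measurable fun ω (q : S) ↦ ⟪W q.1.1 ω, q.1.2⟫)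

variable [MeasurableSpace E] [MeasurableSpace Ω] {P : Measure Ω}

/-- A Brownian motion in a Euclidean space `E`, described without coordinates by the joint Gaussian
law of the linear functionals `⟪W t, v⟫`. Measurability and continuity of paths are required
everywhere, not only almost surely. -/
structure IsRegularBrownian (W : ℝ≥0 → Ω → E) (P : Measure Ω) : Prop where
  measurable : ∀ t, Measurable (W t)
  continuous : ∀ ω, Continuous (W · ω)
  isGaussianProcess : IsGaussianProcess (fun (q : ℝ≥0 × E) ω ↦ ⟪W q.1 ω, q.2⟫) P
  integral_inner : ∀ t v, ∫ ω, ⟪W t ω, v⟫ ∂P = 0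
  covariance_inner : ∀ s t u v,
    cov[fun ω ↦ ⟪W s ω, u⟫, fun ω ↦ ⟪W t ω, v⟫; P] = min (s : ℝ) t * ⟪u, v⟫

lemma measurable_of_inner {Ω : Type*} {m : MeasurableSpace Ω} [FiniteDimensional ℝ E] [BorelSpace E]
    {X : Ω → E} (h : ∀ v, Measurable fun ω ↦ ⟪X ω, v⟫) : Measurable X := by
  let b := stdOrthonormalBasis ℝ E
  have : X = fun ω ↦ ∑ i, ⟪X ω, b i⟫ • b i := by
    ext ω
    conv_lhs => rw [← b.sum_repr' (X ω)]
    simp_rw [real_inner_comm]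
  rw [this]
  exact Finset.measurable_fun_sum _ fun i _ ↦ (h (b i)).smul_const (b i)

namespace IsRegularBrownian

variable {W : ℝ≥0 → Ω → E}

lemma isProbabilityMeasure (hW : IsRegularBrownian W P) : IsProbabilityMeasure P :=
  hW.isGaussianProcess.isProbabilityMeasure

lemma measurable_inner [BorelSpace E] [SecondCountableTopology E]
    (hW : IsRegularBrownian W P) (t : ℝ≥0) (v : E) : Measurable fun ω ↦ ⟪W t ω, v⟫ :=
  (hW.measurable t).inner_const

lemma memLp_inner (hW : IsRegularBrownian W P) (t : ℝ≥0) (v : E) : MemLp (fun ω ↦ ⟪W t ω, v⟫) 2 P :=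
  (hW.isGaussianProcess.hasGaussianLaw_eval (t, v)).memLp_two

lemma sigmaInner_le [BorelSpace E] [SecondCountableTopology E]
    (hW : IsRegularBrownian W P) (S : Set (ℝ≥0 × E)) : sigmaInner W S ≤ ‹MeasurableSpace Ω› :=
  (measurable_pi_lambda _ fun q : S ↦ hW.measurable_inner q.1.1 q.1.2).comap_le

lemma covariance_sub (hW : IsRegularBrownian W P) (s t : ℝ≥0) (c : ℝ) (e : E) (q : ℝ≥0) (v : E) :
    cov[fun ω ↦ ⟪W t ω, e⟫ - c * ⟪W s ω, e⟫, fun ω ↦ ⟪W q ω, v⟫; P]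
      = (min (t : ℝ) q - c * min (s : ℝ) q) * ⟪e, v⟫ := by
  have := hW.isProbabilityMeasure
  rw [covariance_fun_sub_left (hW.memLp_inner t e) ((hW.memLp_inner s e).const_mul c)
    (hW.memLp_inner q v), covariance_const_mul_left, hW.covariance_inner, hW.covariance_inner]
  ring

/-- The linear combinations `⟪W t, e⟫ - c ⟪W s, e⟫` are independent of any functionals of `W`
with which they are uncorrelated. -/
lemma indep_sub [BorelSpace E] [SecondCountableTopology E] (hW : IsRegularBrownian W P)
    (s t : ℝ≥0) (c : ℝ) (e : E) {S : Set (ℝ≥0 × E)}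
    (h : ∀ q ∈ S, (min (t : ℝ) q.1 - c * min (s : ℝ) q.1) * ⟪e, q.2⟫ = 0) :
    Indep (sigmaInner W S)
      (MeasurableSpace.comap (fun ω ↦ ⟪W t ω, e⟫ - c * ⟪W s ω, e⟫) inferInstance) P := by
  classical
  have key : IndepFun (fun ω (_ : Unit) ↦ ⟪W t ω, e⟫ - c * ⟪W s ω, e⟫)
      (fun ω (q : S) ↦ ⟪W q.1.1 ω, q.1.2⟫) P := by
    refine IsGaussianProcess.indepFun_of_covariance_eq_zero
      (X := fun (_ : Unit) ω ↦ ⟪W t ω, e⟫ - c * ⟪W s ω, e⟫)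
      (Y := fun (q : S) ω ↦ ⟪W q.1.1 ω, q.1.2⟫) ?_ ?_ ?_ ?_
    · refine hW.isGaussianProcess.of_isGaussianProcess ?_
      rintro (_ | q)
      · exact ⟨{(t, e), (s, e)},
          ContinuousLinearMap.proj ⟨(t, e), by simp⟩
            - c • ContinuousLinearMap.proj ⟨(s, e), by simp⟩, by simp⟩
      · exact ⟨{q.1}, ContinuousLinearMap.proj ⟨q.1, by simp⟩, by simp⟩
    · exact fun _ ↦ ((hW.measurable_inner t e).sub
        ((hW.measurable_inner s e).const_mul c)).aemeasurable
    · exact fun q ↦ (hW.measurable_inner _ _).aemeasurable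
    · exact fun _ q ↦ (hW.covariance_sub s t c e q.1.1 q.1.2).trans (h q.1 q.2)
  exact (key.comp (measurable_pi_apply ()) measurable_id).symm

lemma hasLaw_sub (hW : IsRegularBrownian W P) {s t : ℝ≥0} {c : ℝ} {e : E} (he : ‖e‖ = 1) {v : ℝ≥0}
    (hv : (v : ℝ) = t - 2 * c * min (s : ℝ) t + c ^ 2 * s) :
    HasLaw (fun ω ↦ ⟪W t ω, e⟫ - c * ⟪W s ω, e⟫) (gaussianReal 0 v) P := by
  classical
  have := hW.isProbabilityMeasure
  have hg : HasGaussianLaw (fun ω ↦ ⟪W t ω, e⟫ - c * ⟪W s ω, e⟫) P := by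
    have : IsGaussianProcess (fun (_ : Unit) ω ↦ ⟪W t ω, e⟫ - c * ⟪W s ω, e⟫) P :=
      hW.isGaussianProcess.of_isGaussianProcess fun _ ↦ ⟨{(t, e), (s, e)},
          ContinuousLinearMap.proj ⟨(t, e), by simp⟩
            - c • ContinuousLinearMap.proj ⟨(s, e), by simp⟩, by simp⟩
    exact this.hasGaussianLaw_eval ()
  have hint : ∫ ω, (⟪W t ω, e⟫ - c * ⟪W s ω, e⟫) ∂P = 0 := by
    rw [integral_sub ((hW.memLp_inner t e).integrable one_le_two)
      (((hW.memLp_inner s e).integrable one_le_two).const_mul c), integral_const_mul,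
      hW.integral_inner, hW.integral_inner]
    simp
  have hvar : Var[fun ω ↦ ⟪W t ω, e⟫ - c * ⟪W s ω, e⟫; P] = v := by
    rw [← covariance_self hg.aemeasurable, covariance_comm,
      covariance_fun_sub_left (hW.memLp_inner t e) ((hW.memLp_inner s e).const_mul c)
      hg.memLp_two, covariance_const_mul_left, covariance_comm, hW.covariance_sub,
      covariance_comm, hW.covariance_sub, real_inner_self_eq_norm_sq, he, hv]
    rw [min_self, min_self, min_comm (t : ℝ) s]
    ring
  refine ⟨hg.aemeasurable, ?_⟩
  rw [hg.map_eq_gaussianReal, hint, hvar, Real.toNNReal_coe]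

end IsRegularBrownian

end Brownian

/-! ### Moments of discretised covariations -/

section Discrete

open scoped RealInnerProductSpace

variable {E Ω : Type*} [NormedAddCommGroup E] [InnerProductSpace ℝ E]

/-- The increment over `[k / n, (k + 1) / n]` of the component of `W` along `e`. -/
noncomputable def gridIncr (W : ℝ≥0 → Ω → E) (e : E) (n k : ℕ) (ω : Ω) : ℝ :=
  ⟪W (((k + 1 : ℕ) : ℝ≥0) / n) ω, e⟫ - ⟪W (k / n) ω, e⟫

/-- The discretised covariation of `F k (W t)` with `⟪W t, e⟫` along the grid `k / n`, where only
the component of `W` along `e` is moved in `F k`. -/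
noncomputable def gridCovariation (W : ℝ≥0 → Ω → E) (e : E) (n : ℕ) (F : ℕ → E → ℝ) (ω : Ω) : ℝ :=
  ∑ k ∈ Finset.range n,
    (F k (W (k / n) ω + gridIncr W e n k ω • e) - F k (W (k / n) ω)) * gridIncr W e n k ω

/-- The part of `W (k / n)` along `e` that is not predicted by later values of `W`. -/
noncomputable def bridgeIncr (W : ℝ≥0 → Ω → E) (e : E) (n k : ℕ) (ω : Ω) : ℝ :=
  ⟪W (k / n) ω, e⟫ - (k / (k + 1) : ℝ) * ⟪W (((k + 1 : ℕ) : ℝ≥0) / n) ω, e⟫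

/-- The indices `(t, v)` of the values known at time `k / n`. -/
def pastIndices (E : Type*) (n k : ℕ) : Set (ℝ≥0 × E) := {q | q.1 ≤ k / n}

/-- The component along `e` from time `(k + 1) / n` on, and the orthogonal components at all
times. -/
def futureIndices (e : E) (n k : ℕ) : Set (ℝ≥0 × E) :=
  {q | ((k + 1 : ℕ) : ℝ≥0) / n ≤ q.1 ∧ q.2 = e ∨ ⟪e, q.2⟫ = 0}

lemma measurable_gridIncr_past (W : ℝ≥0 → Ω → E) (e : E) {n k j : ℕ} (hj : j < k) :
    Measurable[sigmaInner W (pastIndices E n k)] (gridIncr W e n j) :=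
  (measurable_inner_sigmaInner W
    (show ((j + 1 : ℕ) : ℝ≥0) / n ≤ k / n by gcongr; exact_mod_cast hj)).sub
  (measurable_inner_sigmaInner W (show (j : ℝ≥0) / n ≤ k / n by gcongr))

lemma measurable_bridgeIncr_future (W : ℝ≥0 → Ω → E) (e : E) {n k j : ℕ} (hj : k < j) :
    Measurable[sigmaInner W (futureIndices e n k)] (bridgeIncr W e n j) := by
  have h1 : ((j / n : ℝ≥0), e) ∈ futureIndices e n k :=
    Or.inl ⟨div_le_div_of_nonneg_right (by exact_mod_cast hj) (by simp), rfl⟩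
  have h2 : (((j + 1 : ℕ) : ℝ≥0) / n, e) ∈ futureIndices e n k :=
    Or.inl ⟨div_le_div_of_nonneg_right (by exact_mod_cast by omega) (by simp), rfl⟩
  exact (measurable_inner_sigmaInner W h1).sub ((measurable_inner_sigmaInner W h2).const_mul _)

/-- The discretised covariation is a drift minus a backward and a forward martingale transform. -/
lemma gridCovariation_eq (W : ℝ≥0 → Ω → E) (e : E) (n : ℕ) (F : ℕ → E → ℝ) (ω : Ω) :
    gridCovariation W e n F ω =
      ∑ k ∈ Finset.range n, F k (W (k / n) ω + gridIncr W e n k ω • e) *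
        (⟪W (((k + 1 : ℕ) : ℝ≥0) / n) ω, e⟫ / (k + 1)) -
      ∑ k ∈ Finset.range n, F k (W (k / n) ω + gridIncr W e n k ω • e) * bridgeIncr W e n k ω -
      ∑ k ∈ Finset.range n, F k (W (k / n) ω) * gridIncr W e n k ω := by
  rw [gridCovariation, ← Finset.sum_sub_distrib, ← Finset.sum_sub_distrib]
  refine Finset.sum_congr rfl fun k _ ↦ ?_
  have : gridIncr W e n k ω =
      ⟪W (((k + 1 : ℕ) : ℝ≥0) / n) ω, e⟫ / (k + 1) - bridgeIncr W e n k ω := by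
    simp only [gridIncr, bridgeIncr]
    field_simp
    ring
  rw [← mul_sub, ← this, sub_mul]

lemma pow_sub_sub_le (m : ℕ) (a b c : ℝ) :
    (a - b - c) ^ (2 * m) ≤ 9 ^ m / 3 * (a ^ (2 * m) + b ^ (2 * m) + c ^ (2 * m)) := by
  have h := Real.pow_arith_mean_le_arith_mean_pow_of_even Finset.univ (fun _ : Fin 3 ↦ (1 / 3 : ℝ))
    ![3 * a, -(3 * b), -(3 * c)] (fun _ _ ↦ by norm_num) (by simp) (even_two_mul m)
  simp only [Fin.sum_univ_three, Matrix.cons_val_zero, Matrix.cons_val_one, Matrix.cons_val,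
    (even_two_mul m).neg_pow, mul_pow] at h
  have h9 : (3 : ℝ) ^ (2 * m) = 9 ^ m := by rw [pow_mul]; norm_num
  rw [h9] at h
  calc (a - b - c) ^ (2 * m)
      = (1 / 3 * (3 * a) + 1 / 3 * -(3 * b) + 1 / 3 * -(3 * c)) ^ (2 * m) := by
        congr 1; ring
    _ ≤ _ := h
    _ = _ := by ring

lemma sum_one_div_sqrt_le (n : ℕ) : ∑ k ∈ Finset.range n, 1 / √((k : ℝ) + 1) ≤ 2 * √n := by
  induction n with
  | zero => simp
  | succ n ih =>
    rw [Finset.sum_range_succ]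
    have h1 : 0 < √((n : ℝ) + 1) := by positivity
    have h2 : √((n : ℝ) + 1) ^ 2 = n + 1 := Real.sq_sqrt (by positivity)
    have h3 : √(n : ℝ) ^ 2 = n := Real.sq_sqrt (by positivity)
    have h4 : 1 / √((n : ℝ) + 1) ≤ 2 * (√((n : ℝ) + 1) - √n) := by
      rw [div_le_iff₀ h1]
      nlinarith [sq_nonneg (√((n : ℝ) + 1) - √n)]
    push_cast
    linarith

variable [MeasurableSpace E]

lemma measurable_eval_past [FiniteDimensional ℝ E] [BorelSpace E]
    (W : ℝ≥0 → Ω → E) {n k j : ℕ} (hj : j ≤ k) :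
    Measurable[sigmaInner W (pastIndices E n k)] (W (j / n)) :=
  measurable_of_inner fun v ↦
    measurable_inner_sigmaInner W (show (j : ℝ≥0) / n ≤ k / n by gcongr)

lemma measurable_shift_future [FiniteDimensional ℝ E] [BorelSpace E]
    (W : ℝ≥0 → Ω → E) {e : E} (he : ‖e‖ = 1) {n k j : ℕ} (hj : k ≤ j) :
    Measurable[sigmaInner W (futureIndices e n k)]
      (fun ω ↦ W (j / n) ω + gridIncr W e n j ω • e) := by
  refine measurable_of_inner fun v ↦ ?_
  have h1 : ((j / n : ℝ≥0), v - ⟪e, v⟫ • e) ∈ futureIndices e n k := by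
    right
    simp [inner_sub_right, inner_smul_right, he]
  have h2 : (((j + 1 : ℕ) : ℝ≥0) / n, e) ∈ futureIndices e n k := by
    left
    exact ⟨div_le_div_of_nonneg_right (by exact_mod_cast by omega) (by simp), rfl⟩
  convert (measurable_inner_sigmaInner W h1).add
    ((measurable_inner_sigmaInner W h2).mul_const ⟪e, v⟫) using 1
  ext ω
  simp only [gridIncr, inner_add_left, inner_smul_left, inner_sub_right, inner_smul_right,
    Pi.add_apply]
  simp
  ring

variable [MeasurableSpace Ω] {P : Measure Ω} {W : ℝ≥0 → Ω → E}

namespace IsRegularBrownian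

lemma hasLaw_gridIncr (hW : IsRegularBrownian W P) {e : E} (he : ‖e‖ = 1) (n k : ℕ) :
    HasLaw (gridIncr W e n k) (gaussianReal 0 (1 / n)) P := by
  have := hW.hasLaw_sub (s := k / n) (t := ((k + 1 : ℕ) : ℝ≥0) / n) (c := 1) he (v := 1 / n) (by
    have : (k : ℝ) / n ≤ (k + 1 : ℝ) / n := by gcongr; linarith
    push_cast
    rw [min_eq_left this]
    ring)
  simp only [one_mul] at this
  exact this

lemma hasSubgaussianMGF_gridIncr (hW : IsRegularBrownian W P) {e : E} (he : ‖e‖ = 1) (n k : ℕ) :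
    HasSubgaussianMGF (gridIncr W e n k) (1 / n) P :=
  hasSubgaussianMGF_of_hasLaw_gaussianReal (hW.hasLaw_gridIncr he n k)

lemma hasSubgaussianMGF_bridgeIncr (hW : IsRegularBrownian W P) {e : E} (he : ‖e‖ = 1)
    {n : ℕ} (hn : 0 < n) (k : ℕ) : HasSubgaussianMGF (bridgeIncr W e n k) (1 / n) P := by
  have := hW.hasLaw_sub (t := k / n) (s := ((k + 1 : ℕ) : ℝ≥0) / n) (c := k / (k + 1)) he
    (v := 1 / n * (k / (k + 1))) (by
      have : (k : ℝ) / n ≤ (k + 1 : ℝ) / n := by gcongr; linarith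
      push_cast
      rw [min_eq_right this]
      field_simp
      ring)
  refine (hasSubgaussianMGF_of_hasLaw_gaussianReal this).mono (mul_le_of_le_one_right' ?_)
  exact div_le_one_of_le₀ (by simp) (by simp)

variable [FiniteDimensional ℝ E] [BorelSpace E]

lemma measurable_gridIncr (hW : IsRegularBrownian W P) (e : E) (n k : ℕ) :
    Measurable (gridIncr W e n k) :=
  (hW.measurable_inner _ e).sub (hW.measurable_inner _ e)

lemma measurable_bridgeIncr (hW : IsRegularBrownian W P) (e : E) (n k : ℕ) :
    Measurable (bridgeIncr W e n k) :=
  (hW.measurable_inner _ e).sub ((hW.measurable_inner _ e).const_mul _)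

lemma indep_gridIncr (hW : IsRegularBrownian W P) (e : E) (n k : ℕ) :
    Indep (sigmaInner W (pastIndices E n k))
      (MeasurableSpace.comap (gridIncr W e n k) inferInstance) P := by
  have := hW.indep_sub (k / n) (((k + 1 : ℕ) : ℝ≥0) / n) 1 e (S := pastIndices E n k) (by
    intro q (hq : q.1 ≤ k / n)
    have h1 : (q.1 : ℝ) ≤ k / n := by exact_mod_cast hq
    have h2 : (k : ℝ) / n ≤ (k + 1 : ℝ) / n := by gcongr; linarith
    push_cast
    rw [min_eq_right h1, min_eq_right (h1.trans h2)]
    ring)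
  simp only [one_mul] at this
  exact this

lemma indep_bridgeIncr (hW : IsRegularBrownian W P) (e : E) {n : ℕ} (hn : 0 < n) (k : ℕ) :
    Indep (sigmaInner W (futureIndices e n k))
      (MeasurableSpace.comap (bridgeIncr W e n k) inferInstance) P := by
  refine hW.indep_sub _ _ _ e ?_
  rintro q (⟨hq, -⟩ | hq)
  · have h1 : ((k + 1 : ℝ)) / n ≤ q.1 := by exact_mod_cast hq
    have h2 : (k : ℝ) / n ≤ (k + 1 : ℝ) / n := by gcongr; linarith
    push_cast
    rw [min_eq_left h1, min_eq_left (h2.trans h1)]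
    field_simp
    simp
  · rw [hq, mul_zero]

lemma hasSubgaussianMGF_forward (hW : IsRegularBrownian W P) {e : E} (he : ‖e‖ = 1)
    {n : ℕ} (hn : 0 < n) {F : ℕ → E → ℝ} {r : ℝ≥0} (mF : ∀ k, Measurable (F k))
    (hF : ∀ k z, |F k z| ≤ r) :
    HasSubgaussianMGF
      (fun ω ↦ ∑ k ∈ Finset.range n, F k (W (k / n) ω) * gridIncr W e n k ω) (r ^ 2) P := by
  have := hW.isProbabilityMeasure
  have h := hasSubgaussianMGF_sum_mul (P := P) (n := n) (a := r) (v := 1 / n)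
    (u := fun k ω ↦ F k (W (k / n) ω)) (ξ := gridIncr W e n)
    (fun k ↦ sigmaInner W (pastIndices E n k)) (fun k _ ↦ hW.sigmaInner_le _)
    (fun k _ ↦ (mF k).comp (measurable_eval_past W le_rfl))
    (fun k _ j hj ↦ ((mF j).comp (measurable_eval_past W hj.le)).mul
      (measurable_gridIncr_past W e hj))
    (fun k _ ↦ hW.measurable_gridIncr e n k) (fun k _ ↦ hW.hasSubgaussianMGF_gridIncr he n k)
    (fun k _ ω ↦ hF k _) (fun k _ ↦ hW.indep_gridIncr e n k)
  convert h using 1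
  have : (n : ℝ≥0) ≠ 0 := by positivity
  field_simp

/-- The backward martingale transform: after the shift by `gridIncr • e`, the argument of `F k`
depends only on the component of `W` along `e` at time `(k + 1) / n` and on the orthogonal
components, of which `bridgeIncr W e n k` is independent. -/
lemma hasSubgaussianMGF_backward (hW : IsRegularBrownian W P) {e : E} (he : ‖e‖ = 1)
    {n : ℕ} (hn : 0 < n) {F : ℕ → E → ℝ} {r : ℝ≥0} (mF : ∀ k, Measurable (F k))
    (hF : ∀ k z, |F k z| ≤ r) :
    HasSubgaussianMGF
      (fun ω ↦ ∑ k ∈ Finset.range n,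
        F k (W (k / n) ω + gridIncr W e n k ω • e) * bridgeIncr W e n k ω) (r ^ 2) P := by
  have := hW.isProbabilityMeasure
  have h := hasSubgaussianMGF_sum_mul (P := P) (n := n) (a := r) (v := 1 / n)
    (u := fun k ω ↦ F (n - 1 - k)
      (W ((n - 1 - k : ℕ) / n) ω + gridIncr W e n (n - 1 - k) ω • e))
    (ξ := fun k ↦ bridgeIncr W e n (n - 1 - k))
    -- the grid is run backwards, so that the information `futureIndices` increases
    (fun k ↦ sigmaInner W (futureIndices e n (n - 1 - k))) (fun k _ ↦ hW.sigmaInner_le _)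
    (fun k _ ↦ (mF _).comp (measurable_shift_future W he le_rfl))
    (fun k hk j hj ↦ ((mF _).comp (measurable_shift_future W he (by omega))).mul
      (measurable_bridgeIncr_future W e (by omega)))
    (fun k _ ↦ hW.measurable_bridgeIncr e n _) (fun k _ ↦ hW.hasSubgaussianMGF_bridgeIncr he hn _)
    (fun k _ ω ↦ hF _ _) (fun k _ ↦ hW.indep_bridgeIncr e hn _)
  convert h using 1
  · ext ω
    exact (Finset.sum_range_reflect (fun k ↦
      F k (W (k / n) ω + gridIncr W e n k ω • e) * bridgeIncr W e n k ω) n).symm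
  · have : (n : ℝ≥0) ≠ 0 := by positivity
    field_simp

/-- The predictable drift of the time-reversed increments. With `t = (k + 1) / n` its terms are
`n⁻¹ |⟪W t, e⟫| / t`, of size `n⁻¹ t ^ (-1/2)`, and `∑ n⁻¹ t ^ (-1/2) ≤ 2`; the moments are then
bounded by Jensen's inequality. -/
lemma integral_drift_pow_le (hW : IsRegularBrownian W P) {e : E} (he : ‖e‖ = 1)
    {n : ℕ} (hn : 0 < n) {u : ℕ → Ω → ℝ} {r : ℝ≥0} (mu : ∀ k, Measurable (u k))
    (hu : ∀ k ω, |u k ω| ≤ r) {m : ℕ} (hm : 0 < m) :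
    Integrable (fun ω ↦ (∑ k ∈ Finset.range n,
      u k ω * (⟪W (((k + 1 : ℕ) : ℝ≥0) / n) ω, e⟫ / (k + 1))) ^ (2 * m)) P ∧
    ∫ ω, (∑ k ∈ Finset.range n,
      u k ω * (⟪W (((k + 1 : ℕ) : ℝ≥0) / n) ω, e⟫ / (k + 1))) ^ (2 * m) ∂P
      ≤ (64 * r ^ 2) ^ m * m ! := by
  have := hW.isProbabilityMeasure
  have hnr : (0 : ℝ) < n := by exact_mod_cast hn
  -- `N k` is a standard normal variable
  let N : ℕ → Ω → ℝ := fun k ω ↦ √(n / (k + 1)) * ⟪W (((k + 1 : ℕ) : ℝ≥0) / n) ω, e⟫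
  have hN (k : ℕ) : HasSubgaussianMGF (N k) 1 P := by
    have h1 := hW.hasLaw_sub (t := ((k + 1 : ℕ) : ℝ≥0) / n) (s := 0) (c := 0) he
      (v := ((k + 1 : ℕ) : ℝ≥0) / n) (by simp)
    have h2 := (hasSubgaussianMGF_of_hasLaw_gaussianReal h1).const_mul (√(n / (k + 1)))
    simp only [zero_mul, sub_zero] at h2
    refine h2.mono (le_of_eq (NNReal.eq ?_))
    change √((n : ℝ) / (k + 1)) ^ 2 * (((k + 1 : ℕ) : ℝ) / n) = 1
    rw [Real.sq_sqrt (by positivity)]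
    push_cast
    field_simp
  have mN (k : ℕ) : Measurable (N k) := (hW.measurable_inner _ e).const_mul _
  let w : ℕ → ℝ := fun k ↦ 1 / √n * (1 / √(k + 1))
  have hw0 (k : ℕ) : 0 < w k := by positivity
  have hwN (k : ℕ) (ω : Ω) : w k * N k ω = ⟪W (((k + 1 : ℕ) : ℝ≥0) / n) ω, e⟫ / (k + 1) := by
    have h3 : √((k : ℝ) + 1) ^ 2 = k + 1 := Real.sq_sqrt (by positivity)
    simp only [w, N]
    rw [Real.sqrt_div hnr.le]
    have h4 : √(n : ℝ) ≠ 0 := by positivity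
    have h5 : √((k : ℝ) + 1) ≠ 0 := by positivity
    field_simp
    rw [h3]
  set A : ℝ := ∑ k ∈ Finset.range n, w k with hA
  have hA0 : 0 < A := Finset.sum_pos (fun k _ ↦ hw0 k) (by simpa using hn.ne')
  have hA2 : A ≤ 2 := by
    rw [hA, ← Finset.mul_sum]
    calc 1 / √n * ∑ k ∈ Finset.range n, 1 / √((k : ℝ) + 1) ≤ 1 / √n * (2 * √n) := by
          gcongr; exact sum_one_div_sqrt_le n
      _ = 2 := by field_simp
  have hpt (ω : Ω) : (∑ k ∈ Finset.range n,
      u k ω * (⟪W (((k + 1 : ℕ) : ℝ≥0) / n) ω, e⟫ / (k + 1))) ^ (2 * m)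
      ≤ ∑ k ∈ Finset.range n, w k / A * ((2 * r) ^ (2 * m) * N k ω ^ (2 * m)) := by
    calc _ = (∑ k ∈ Finset.range n, w k / A * (A * u k ω * N k ω)) ^ (2 * m) := by
          congr 1
          refine Finset.sum_congr rfl fun k _ ↦ ?_
          rw [← hwN]
          field_simp
      _ ≤ ∑ k ∈ Finset.range n, w k / A * (A * u k ω * N k ω) ^ (2 * m) :=
          Real.pow_arith_mean_le_arith_mean_pow_of_even _ _ _
            (fun k _ ↦ div_nonneg (hw0 k).le hA0.le)
            (by rw [← Finset.sum_div, ← hA, div_self hA0.ne']) (even_two_mul m)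
      _ ≤ _ := by
          refine Finset.sum_le_sum fun k _ ↦ ?_
          rw [mul_pow]
          refine mul_le_mul_of_nonneg_left (mul_le_mul_of_nonneg_right ?_
            ((even_two_mul m).pow_nonneg _)) (div_nonneg (hw0 k).le hA0.le)
          rw [← (even_two_mul m).pow_abs, abs_mul, abs_of_pos hA0]
          exact pow_le_pow_left₀ (by positivity)
            (mul_le_mul hA2 (hu k ω) (abs_nonneg _) zero_le_two) _
  have hintN (k : ℕ) : Integrable
      (fun ω ↦ w k / A * ((2 * (r : ℝ)) ^ (2 * m) * N k ω ^ (2 * m))) P :=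
    (((hN k).integrable_pow _).const_mul _).const_mul _
  have hint := integrable_finsetSum (Finset.range n) fun k _ ↦ hintN k
  have hmeas : Measurable (fun ω ↦ (∑ k ∈ Finset.range n,
      u k ω * (⟪W (((k + 1 : ℕ) : ℝ≥0) / n) ω, e⟫ / (k + 1))) ^ (2 * m)) :=
    (Finset.measurable_fun_sum _ fun k _ ↦
      (mu k).mul ((hW.measurable_inner _ e).div_const _)).pow_const _
  have hI := hint.mono' hmeas.aestronglyMeasurable (.of_forall fun ω ↦ by
    rw [Real.norm_of_nonneg ((even_two_mul m).pow_nonneg _)]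
    exact hpt ω)
  refine ⟨hI, (integral_mono hI hint hpt).trans ?_⟩
  rw [integral_finsetSum _ fun k _ ↦ hintN k]
  calc _ ≤ ∑ k ∈ Finset.range n, w k / A * ((64 * r ^ 2) ^ m * m !) := by
        refine Finset.sum_le_sum fun k _ ↦ ?_
        rw [integral_const_mul, integral_const_mul]
        refine mul_le_mul_of_nonneg_left ?_ (div_nonneg (hw0 k).le hA0.le)
        have h1 := (hN k).integral_pow_le one_pos hm
        calc (2 * (r : ℝ)) ^ (2 * m) * ∫ ω, N k ω ^ (2 * m) ∂P
            ≤ (2 * (r : ℝ)) ^ (2 * m) * ((16 * (1 : ℝ≥0)) ^ m * m !) := by gcongr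
          _ = _ := by
            rw [pow_mul, ← mul_assoc, ← mul_pow]
            congr 2
            push_cast
            ring
    _ = _ := by rw [← Finset.sum_mul, ← Finset.sum_div, ← hA, div_self hA0.ne', one_mul]

lemma measurable_gridCovariation (hW : IsRegularBrownian W P) (e : E) (n : ℕ) {F : ℕ → E → ℝ}
    (mF : ∀ k, Measurable (F k)) : Measurable (gridCovariation W e n F) :=
  Finset.measurable_fun_sum _ fun k _ ↦ (((mF k).comp ((hW.measurable _).add
    ((hW.measurable_gridIncr e n k).smul_const e))).sub ((mF k).comp (hW.measurable _))).mul
      (hW.measurable_gridIncr e n k)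

lemma integral_gridCovariation_pow_le (hW : IsRegularBrownian W P) {e : E} (he : ‖e‖ = 1)
    {n : ℕ} (hn : 0 < n) {F : ℕ → E → ℝ} {r : ℝ≥0} (hr : 0 < r) (mF : ∀ k, Measurable (F k))
    (hF : ∀ k z, |F k z| ≤ r) {m : ℕ} (hm : 0 < m) :
    Integrable (fun ω ↦ gridCovariation W e n F ω ^ (2 * m)) P ∧
    ∫ ω, gridCovariation W e n F ω ^ (2 * m) ∂P ≤ (576 * r ^ 2) ^ m * m ! := by
  have := hW.isProbabilityMeasure
  have h1 := hW.integral_drift_pow_le he hn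
    (u := fun k ω ↦ F k (W (k / n) ω + gridIncr W e n k ω • e))
    (fun k ↦ (mF k).comp ((hW.measurable _).add
      ((hW.measurable_gridIncr e n k).smul_const e))) (fun k ω ↦ hF k _) hm
  have hb := hW.hasSubgaussianMGF_backward he hn mF hF
  have hc := hW.hasSubgaussianMGF_forward he hn mF hF
  have hb2 := hb.integral_pow_le (pow_pos hr 2) hm
  have hc2 := hc.integral_pow_le (pow_pos hr 2) hm
  have hint := ((h1.1.add (hb.integrable_pow (2 * m))).add
    (hc.integrable_pow (2 * m))).const_mul (9 ^ m / 3)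
  have hpt (ω : Ω) := pow_sub_sub_le m (∑ k ∈ Finset.range n,
      F k (W (k / n) ω + gridIncr W e n k ω • e) * (⟪W (((k + 1 : ℕ) : ℝ≥0) / n) ω, e⟫ / (k + 1)))
    (∑ k ∈ Finset.range n, F k (W (k / n) ω + gridIncr W e n k ω • e) * bridgeIncr W e n k ω)
    (∑ k ∈ Finset.range n, F k (W (k / n) ω) * gridIncr W e n k ω)
  simp_rw [← gridCovariation_eq] at hpt
  have hI : Integrable (fun ω ↦ gridCovariation W e n F ω ^ (2 * m)) P :=
    hint.mono' ((hW.measurable_gridCovariation e n mF).pow_const _).aestronglyMeasurable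
      (.of_forall fun ω ↦ by
        rw [Real.norm_of_nonneg ((even_two_mul m).pow_nonneg _)]
        exact hpt ω)
  refine ⟨hI, (integral_mono hI hint hpt).trans ?_⟩
  rw [integral_const_mul]
  rw [integral_add' (h1.1.add (hb.integrable_pow (2 * m))) (hc.integrable_pow (2 * m)),
    integral_add' h1.1 (hb.integrable_pow (2 * m))]
  push_cast at hb2 hc2
  have h16 : (16 * (r : ℝ) ^ 2) ^ m * m ! ≤ (64 * (r : ℝ) ^ 2) ^ m * m ! := by
    gcongr
    norm_num
  calc _ ≤ 9 ^ m / 3 * ((64 * (r : ℝ) ^ 2) ^ m * m ! + (64 * (r : ℝ) ^ 2) ^ m * m !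
        + (64 * (r : ℝ) ^ 2) ^ m * m !) := by
        gcongr
        · exact h1.2
        · exact hb2.trans h16
        · exact hc2.trans h16
    _ = (9 * (64 * r ^ 2)) ^ m * m ! := by
        rw [mul_pow 9]
        ring
    _ = _ := by
        rw [← mul_assoc]
        norm_num

end IsRegularBrownian

end Discrete

/-! ### Convergence of discretised covariations -/

section Convergence

open scoped RealInnerProductSpace

variable {Ω : Type*} [MeasurableSpace Ω] {P : Measure Ω}

/-- Orthogonality of martingale increments, for a martingale transform with bounded weights. -/
lemma integral_sq_sum_mul_le [IsProbabilityMeasure P] {u η : ℕ → Ω → ℝ} {a v : ℝ} {n : ℕ}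
    (𝓕 : ℕ → MeasurableSpace Ω) (h𝓕 : ∀ k, 𝓕 k ≤ ‹MeasurableSpace Ω›)
    (mu : ∀ k, Measurable[𝓕 k] (u k)) (mu' : ∀ k, ∀ j < k, Measurable[𝓕 k] (u j))
    (mη : ∀ k, ∀ j < k, Measurable[𝓕 k] (η j))
    (hη : ∀ k, MemLp (η k) 2 P) (hη0 : ∀ k, ∫ ω, η k ω ∂P = 0)
    (hη2 : ∀ k, ∫ ω, η k ω ^ 2 ∂P ≤ v) (hu : ∀ k ω, |u k ω| ≤ a)
    (hind : ∀ k, Indep (𝓕 k) (MeasurableSpace.comap (η k) inferInstance) P) :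
    MemLp (fun ω ↦ ∑ k ∈ Finset.range n, u k ω * η k ω) 2 P ∧
    ∫ ω, (∑ k ∈ Finset.range n, u k ω * η k ω) ^ 2 ∂P ≤ n * (a ^ 2 * v) := by
  have hterm (k : ℕ) : MemLp (fun ω ↦ u k ω * η k ω) 2 P :=
    (hη k).of_le_mul (c := a)
      (((mu k).mono (h𝓕 k) le_rfl).aestronglyMeasurable.mul (hη k).aestronglyMeasurable)
      (.of_forall fun ω ↦ by
        rw [norm_mul]
        exact mul_le_mul_of_nonneg_right (hu k ω) (norm_nonneg _))
  have hM (n : ℕ) : MemLp (fun ω ↦ ∑ k ∈ Finset.range n, u k ω * η k ω) 2 P :=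
    memLp_finsetSum _ fun k _ ↦ hterm k
  refine ⟨hM n, ?_⟩
  induction n with
  | zero => simp
  | succ n ih =>
    set M : Ω → ℝ := fun ω ↦ ∑ k ∈ Finset.range n, u k ω * η k ω with hMdef
    have mM : Measurable[𝓕 n] M := Finset.measurable_fun_sum _ fun k hk ↦
      (mu' n k (Finset.mem_range.1 hk)).mul (mη n k (Finset.mem_range.1 hk))
    have hMu : MemLp (fun ω ↦ M ω * u n ω) 2 P :=
      (hM n).of_le_mul (c := a)
        ((hM n).aestronglyMeasurable.mul ((mu n).mono (h𝓕 n) le_rfl).aestronglyMeasurable)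
        (.of_forall fun ω ↦ by
          rw [norm_mul, mul_comm]
          exact mul_le_mul_of_nonneg_right (hu n ω) (norm_nonneg _))
    have hcross : ∫ ω, (M ω * u n ω) * η n ω ∂P = 0 := by
      have hi : IndepFun (fun ω ↦ M ω * u n ω) (η n) P := (IndepFun_iff_Indep _ _ _).2
        (indep_of_indep_of_le_left (hind n) (mM.mul (mu n)).comap_le)
      have := hi.integral_mul_eq_mul_integral hMu.aestronglyMeasurable (hη n).aestronglyMeasurable
      simpa [hη0 n] using this
    have hcrossI : Integrable (fun ω ↦ (M ω * u n ω) * η n ω) P := hMu.integrable_mul (hη n)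
    have hsq : ∫ ω, (u n ω * η n ω) ^ 2 ∂P ≤ a ^ 2 * v := by
      calc _ ≤ ∫ ω, a ^ 2 * η n ω ^ 2 ∂P := by
            refine integral_mono (hterm n).integrable_sq ((hη n).integrable_sq.const_mul _)
              fun ω ↦ ?_
            simp only [mul_pow]
            exact mul_le_mul_of_nonneg_right
              (sq_le_sq' (abs_le.1 (hu n ω)).1 (abs_le.1 (hu n ω)).2) (sq_nonneg _)
        _ ≤ _ := by
            rw [integral_const_mul]
            exact mul_le_mul_of_nonneg_left (hη2 n) (sq_nonneg _)
    calc ∫ ω, (∑ k ∈ Finset.range (n + 1), u k ω * η k ω) ^ 2 ∂P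
        = ∫ ω, (M ω ^ 2 + (2 * ((M ω * u n ω) * η n ω) + (u n ω * η n ω) ^ 2)) ∂P := by
          refine integral_congr_ae (.of_forall fun ω ↦ ?_)
          simp only [Finset.sum_range_succ, hMdef]
          ring
      _ = ∫ ω, M ω ^ 2 ∂P + ∫ ω, (u n ω * η n ω) ^ 2 ∂P := by
          have hB : Integrable
              (fun ω ↦ 2 * ((M ω * u n ω) * η n ω) + (u n ω * η n ω) ^ 2) P :=
            (hcrossI.const_mul 2).add (hterm n).integrable_sq
          rw [integral_add (hM n).integrable_sq hB,
            integral_add (hcrossI.const_mul 2) (hterm n).integrable_sq, integral_const_mul, hcross]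
          ring
      _ ≤ n * (a ^ 2 * v) + a ^ 2 * v := add_le_add ih hsq
      _ = _ := by push_cast; ring

variable {E : Type*} [NormedAddCommGroup E] [InnerProductSpace ℝ E] [MeasurableSpace E]
  {W : ℝ≥0 → Ω → E}

namespace IsRegularBrownian

lemma integral_gridIncr_sq (hW : IsRegularBrownian W P) {e : E} (he : ‖e‖ = 1) (n k : ℕ) :
    ∫ ω, gridIncr W e n k ω ^ 2 ∂P = 1 / n := by
  have h := hW.hasLaw_gridIncr he n k
  have h0 : ∫ ω, gridIncr W e n k ω ∂P = 0 := by rw [h.integral_eq, integral_id_gaussianReal]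
  have h1 := h.variance_eq
  rw [variance_id_gaussianReal, variance_of_integral_eq_zero h.aemeasurable h0] at h1
  simpa using h1

lemma integral_gridIncr_pow_four_le (hW : IsRegularBrownian W P) {e : E} (he : ‖e‖ = 1) {n : ℕ}
    (hn : 0 < n) (k : ℕ) : ∫ ω, gridIncr W e n k ω ^ 4 ∂P ≤ 512 / n ^ 2 := by
  have := hW.isProbabilityMeasure
  have h := (hW.hasSubgaussianMGF_gridIncr he n k).integral_pow_le (by positivity) two_pos
  refine h.trans (le_of_eq ?_)
  push_cast
  norm_num [Nat.factorial]
  ring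

lemma integrable_gridIncr_pow (hW : IsRegularBrownian W P) {e : E} (he : ‖e‖ = 1) (n k p : ℕ) :
    Integrable (fun ω ↦ gridIncr W e n k ω ^ p) P :=
  have := hW.isProbabilityMeasure
  (hW.hasSubgaussianMGF_gridIncr he n k).integrable_pow p

variable [FiniteDimensional ℝ E] [BorelSpace E]

/-- Replacing squared increments by their mean `1 / n` costs `O(n ^ (-1/2))` in `L²`. -/
lemma integral_sq_sum_mul_gridIncr_le (hW : IsRegularBrownian W P) {e : E} (he : ‖e‖ = 1) {n : ℕ}
    (hn : 0 < n) {H : ℕ → E → ℝ} (mH : ∀ k, Measurable (H k)) (hH : ∀ k z, |H k z| ≤ 2) :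
    MemLp (fun ω ↦ ∑ k ∈ Finset.range n,
      H k (W (k / n) ω) * (gridIncr W e n k ω ^ 2 - 1 / n)) 2 P ∧
    ∫ ω, (∑ k ∈ Finset.range n,
      H k (W (k / n) ω) * (gridIncr W e n k ω ^ 2 - 1 / n)) ^ 2 ∂P ≤ 4104 / (n : ℝ) := by
  have := hW.isProbabilityMeasure
  have hnr : (0 : ℝ) < n := by exact_mod_cast hn
  have hmeas (k : ℕ) : Measurable fun ω ↦ gridIncr W e n k ω ^ 2 - 1 / (n : ℝ) :=
    ((hW.measurable_gridIncr e n k).pow_const 2).sub_const _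
  have hpt (k : ℕ) (ω : Ω) : (gridIncr W e n k ω ^ 2 - 1 / (n : ℝ)) ^ 2
      ≤ 2 * gridIncr W e n k ω ^ 4 + 2 / n ^ 2 := by
    have : (2 : ℝ) / n ^ 2 = 2 * (1 / n) ^ 2 := by ring
    rw [this]
    nlinarith [sq_nonneg (gridIncr W e n k ω ^ 2 + 1 / (n : ℝ))]
  have hint (k : ℕ) : Integrable (fun ω ↦ 2 * gridIncr W e n k ω ^ 4 + 2 / (n : ℝ) ^ 2) P :=
    ((hW.integrable_gridIncr_pow he n k 4).const_mul 2).add (integrable_const _)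
  have hLp (k : ℕ) : MemLp (fun ω ↦ gridIncr W e n k ω ^ 2 - 1 / (n : ℝ)) 2 P := by
    refine (memLp_two_iff_integrable_sq (hmeas k).aestronglyMeasurable).2 ?_
    exact (hint k).mono' ((hmeas k).pow_const 2).aestronglyMeasurable (.of_forall fun ω ↦ by
      rw [Real.norm_of_nonneg (sq_nonneg _)]
      exact hpt k ω)
  have h := integral_sq_sum_mul_le (P := P) (n := n) (a := 2) (v := 1026 / n ^ 2)
    (u := fun k ω ↦ H k (W (k / n) ω)) (η := fun k ω ↦ gridIncr W e n k ω ^ 2 - 1 / (n : ℝ))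
    (fun k ↦ sigmaInner W (pastIndices E n k)) (fun k ↦ hW.sigmaInner_le _)
    (fun k ↦ (mH k).comp (measurable_eval_past W le_rfl))
    (fun k j hj ↦ (mH j).comp (measurable_eval_past W hj.le))
    (fun k j hj ↦ ((measurable_gridIncr_past W e hj).pow_const 2).sub_const _)
    hLp ?_ ?_ (fun k ω ↦ hH k _) ?_
  · refine ⟨h.1, h.2.trans (le_of_eq ?_)⟩
    field_simp
    norm_num
  · intro k
    rw [integral_sub (hW.integrable_gridIncr_pow he n k 2) (integrable_const _),
      hW.integral_gridIncr_sq he]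
    simp
  · intro k
    refine (integral_mono (hLp k).integrable_sq (hint k) (hpt k)).trans ?_
    rw [integral_add ((hW.integrable_gridIncr_pow he n k 4).const_mul 2) (integrable_const _),
      integral_const_mul]
    have := hW.integral_gridIncr_pow_four_le he hn k
    simp only [integral_const, probReal_univ, one_smul]
    calc _ ≤ 2 * (512 / (n : ℝ) ^ 2) + 2 / n ^ 2 := by gcongr
      _ = _ := by ring
  · intro k
    refine indep_of_indep_of_le_right (hW.indep_gridIncr e n k) ?_
    have : Measurable[MeasurableSpace.comap (gridIncr W e n k) inferInstance]
        (gridIncr W e n k) := comap_measurable _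
    exact ((this.pow_const 2).sub_const _).comap_le

/-- If `H k` is the derivative of `F k` along `e`, with a modulus of continuity controlled by `ε`
and `L`, then the discretised covariation of `F k (W t)` is a Riemann sum of `H k (W t)`, up to an
error that is small in `L¹`. -/
lemma integral_abs_gridCovariation_sub_le (hW : IsRegularBrownian W P) {e : E} (he : ‖e‖ = 1)
    {n : ℕ} (hn : 0 < n) {F H : ℕ → E → ℝ} (mF : ∀ k, Measurable (F k))
    (mH : ∀ k, Measurable (H k)) (hH : ∀ k z, |H k z| ≤ 2) {ε L : ℝ} (hε : 0 < ε)
    (hFH : ∀ k z b, |F k (z + b • e) - F k z - b * H k z| ≤ |b| * (ε + L * b ^ 2)) (hL : 0 ≤ L) :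
    Integrable (fun ω ↦ |gridCovariation W e n F ω
      - ∑ k ∈ Finset.range n, H k (W (k / n) ω) * (1 / n)|) P ∧
    ∫ ω, |gridCovariation W e n F ω - ∑ k ∈ Finset.range n, H k (W (k / n) ω) * (1 / n)| ∂P
      ≤ 2 * ε + (512 * L + 4104 / ε) * (1 / n) := by
  have := hW.isProbabilityMeasure
  have hnr : (0 : ℝ) < n := by exact_mod_cast hn
  obtain ⟨hQ, hQ2⟩ := hW.integral_sq_sum_mul_gridIncr_le he hn mH hH
  set Q : Ω → ℝ := fun ω ↦ ∑ k ∈ Finset.range n,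
      H k (W (k / n) ω) * (gridIncr W e n k ω ^ 2 - 1 / n) with hQdef
  let R : Ω → ℝ := fun ω ↦
    ∑ k ∈ Finset.range n, (ε * gridIncr W e n k ω ^ 2 + L * gridIncr W e n k ω ^ 4)
  have hpt (ω : Ω) : |gridCovariation W e n F ω
      - ∑ k ∈ Finset.range n, H k (W (k / n) ω) * (1 / n)| ≤ R ω + (ε + Q ω ^ 2 / ε) := by
    have h1 : gridCovariation W e n F ω - ∑ k ∈ Finset.range n, H k (W (k / n) ω) * (1 / n)
        = ∑ k ∈ Finset.range n, (F k (W (k / n) ω + gridIncr W e n k ω • e) - F k (W (k / n) ω)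
            - gridIncr W e n k ω * H k (W (k / n) ω)) * gridIncr W e n k ω + Q ω := by
      rw [gridCovariation, hQdef, ← Finset.sum_sub_distrib, ← Finset.sum_add_distrib]
      refine Finset.sum_congr rfl fun k _ ↦ ?_
      ring
    rw [h1]
    refine (abs_add_le _ _).trans (add_le_add ?_ ?_)
    · refine (Finset.abs_sum_le_sum_abs _ _).trans (Finset.sum_le_sum fun k _ ↦ ?_)
      rw [abs_mul]
      calc _ ≤ |gridIncr W e n k ω| * (ε + L * gridIncr W e n k ω ^ 2) * |gridIncr W e n k ω| :=
            mul_le_mul_of_nonneg_right (hFH _ _ _) (abs_nonneg _)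
        _ = |gridIncr W e n k ω| ^ 2 * (ε + L * gridIncr W e n k ω ^ 2) := by ring
        _ = _ := by rw [sq_abs]; ring
    · rw [← sq_abs (Q ω)]
      have : 0 ≤ (|Q ω| - ε) ^ 2 / ε := by positivity
      have h2 : (|Q ω| - ε) ^ 2 / ε = |Q ω| ^ 2 / ε - 2 * |Q ω| + ε := by field_simp; ring
      linarith [abs_nonneg (Q ω)]
  have hRk (k : ℕ) :
      Integrable (fun ω ↦ ε * gridIncr W e n k ω ^ 2 + L * gridIncr W e n k ω ^ 4) P :=
    ((hW.integrable_gridIncr_pow he n k 2).const_mul _).add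
      ((hW.integrable_gridIncr_pow he n k 4).const_mul _)
  have hR : Integrable R P := integrable_finsetSum _ fun k _ ↦ hRk k
  have hQI : Integrable (fun ω ↦ ε + Q ω ^ 2 / ε) P :=
    (integrable_const _).add (hQ.integrable_sq.div_const _)
  have hmeas : Measurable fun ω ↦ |gridCovariation W e n F ω
      - ∑ k ∈ Finset.range n, H k (W (k / n) ω) * (1 / n)| :=
    ((hW.measurable_gridCovariation e n mF).sub (Finset.measurable_fun_sum _ fun k _ ↦
      ((mH k).comp (hW.measurable _)).mul_const _)).abs
  have hI := (hR.add hQI).mono' hmeas.aestronglyMeasurable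
    (.of_forall fun ω ↦ by rw [Real.norm_eq_abs, abs_abs]; exact hpt ω)
  refine ⟨hI, (integral_mono hI (hR.add hQI) hpt).trans ?_⟩
  rw [integral_add' hR hQI, integral_add (integrable_const _) (hQ.integrable_sq.div_const _),
    integral_div, integral_finsetSum _ fun k _ ↦ hRk k]
  have h1 : ∑ k ∈ Finset.range n,
      ∫ ω, (ε * gridIncr W e n k ω ^ 2 + L * gridIncr W e n k ω ^ 4) ∂P
      ≤ ∑ k ∈ Finset.range n, (ε * (1 / n) + L * (512 / n ^ 2)) := by
    refine Finset.sum_le_sum fun k _ ↦ ?_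
    rw [integral_add ((hW.integrable_gridIncr_pow he n k 2).const_mul _)
      ((hW.integrable_gridIncr_pow he n k 4).const_mul _), integral_const_mul, integral_const_mul,
      hW.integral_gridIncr_sq he]
    gcongr
    exact hW.integral_gridIncr_pow_four_le he hn k
  have h2 : (∫ ω, Q ω ^ 2 ∂P) / ε ≤ 4104 / n / ε := by gcongr
  have h3 : ∑ k ∈ Finset.range n, (ε * (1 / (n : ℝ)) + L * (512 / n ^ 2))
      = ε + 512 * L * (1 / n) := by
    rw [Finset.sum_const, Finset.card_range, nsmul_eq_mul]
    field_simp
  have h4 : (4104 : ℝ) / n / ε = 4104 / ε * (1 / n) := by field_simp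
  simp only [integral_const, probReal_univ, one_smul]
  linarith

end IsRegularBrownian

end Convergence

/-! ### Continuous integrands -/

section ContinuousIntegrand

open scoped RealInnerProductSpace Topology
open Filter

lemma tendsto_riemann_sum {f : ℝ → ℝ} (hf : Continuous f) :
    Tendsto (fun n : ℕ ↦ ∑ k ∈ Finset.range n, f (k / n) * (1 / n)) atTop
      (𝓝 (∫ t in (0 : ℝ)..1, f t)) := by
  have huc := isCompact_Icc.uniformContinuousOn_of_continuous
    (hf.continuousOn (s := Set.Icc (0 : ℝ) 1))
  rw [Metric.uniformContinuousOn_iff_le] at huc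
  rw [Metric.tendsto_atTop]
  intro ε hε
  obtain ⟨δ, hδ, h⟩ := huc (ε / 2) (half_pos hε)
  obtain ⟨N, hN⟩ := exists_nat_gt (1 / δ)
  refine ⟨N, fun n hn ↦ ?_⟩
  have hNr : (0 : ℝ) < N := lt_trans (by positivity) hN
  have hnN : (N : ℝ) ≤ n := by exact_mod_cast hn
  have hnr : (0 : ℝ) < n := hNr.trans_le hnN
  have hnδ : 1 / (n : ℝ) ≤ δ := by
    rw [div_le_iff₀ hnr]
    rw [div_lt_iff₀ hδ] at hN
    nlinarith
  have hsplit : ∫ t in (0 : ℝ)..1, f t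
      = ∑ k ∈ Finset.range n, ∫ t in ((k : ℝ) / n)..((k + 1 : ℕ) / n), f t := by
    have := intervalIntegral.sum_integral_adjacent_intervals (f := f) (μ := volume)
      (a := fun k : ℕ ↦ (k : ℝ) / n) (n := n) fun k _ ↦ hf.intervalIntegrable _ _
    rw [this]
    simp [hnr.ne']
  rw [hsplit, Real.dist_eq, ← Finset.sum_sub_distrib]
  calc _ ≤ ∑ k ∈ Finset.range n, ε / 2 * (1 / n) := by
        refine (Finset.abs_sum_le_sum_abs _ _).trans (Finset.sum_le_sum fun k hk ↦ ?_)
        have hlen : ((k + 1 : ℕ) : ℝ) / n - k / n = 1 / n := by push_cast; ring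
        have hle : (k : ℝ) / n ≤ (k + 1 : ℕ) / n := by
          have : 0 ≤ 1 / (n : ℝ) := by positivity
          linarith
        have hk1 : ((k + 1 : ℕ) : ℝ) / n ≤ 1 := by
          rw [div_le_one hnr]
          exact_mod_cast Finset.mem_range.1 hk
        have hk0 : 0 ≤ (k : ℝ) / n := by positivity
        have : f (k / n) * (1 / n) - ∫ t in ((k : ℝ) / n)..((k + 1 : ℕ) / n), f t
            = ∫ t in ((k : ℝ) / n)..((k + 1 : ℕ) / n), (f (k / n) - f t) := by
          rw [intervalIntegral.integral_sub intervalIntegrable_const (hf.intervalIntegrable _ _),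
            intervalIntegral.integral_const, hlen, smul_eq_mul, mul_comm]
        rw [this]
        have hb := intervalIntegral.norm_integral_le_of_norm_le_const
          (f := fun t ↦ f (k / n) - f t) (C := ε / 2) (a := (k : ℝ) / n)
          (b := (k + 1 : ℕ) / n) fun t ht ↦ by
            rw [Set.uIoc_of_le hle] at ht
            refine h _ ⟨hk0, hle.trans hk1⟩ t ⟨hk0.trans ht.1.le, ht.2.trans hk1⟩ ?_
            rw [Real.dist_eq, abs_le]
            constructor <;> linarith [ht.1, ht.2]
        rwa [hlen, abs_of_pos (by positivity)] at hb
    _ = ε / 2 := by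
        rw [Finset.sum_const, Finset.card_range, nsmul_eq_mul]
        field_simp
    _ < ε := half_lt_self hε

/-- A bounded uniformly continuous function has a quadratic modulus of continuity up to `ε`; the
square makes the resulting errors even moments of Gaussian increments. -/
lemma UniformContinuous.exists_abs_sub_le {X : Type*} [PseudoMetricSpace X] {f : X → ℝ}
    (h : UniformContinuous f) (h2 : ∀ q, |f q| ≤ 2) {ε : ℝ} (hε : 0 < ε) :
    ∃ L : ℝ, 0 ≤ L ∧ ∀ q q', |f q - f q'| ≤ ε + L * dist q q' ^ 2 := by
  obtain ⟨δ, hδ, hd⟩ := Metric.uniformContinuous_iff.1 h ε hε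
  refine ⟨4 / δ ^ 2, by positivity, fun q q' ↦ ?_⟩
  rcases lt_or_ge (dist q q') δ with hlt | hge
  · have h3 : 0 ≤ 4 / δ ^ 2 * dist q q' ^ 2 := by positivity
    have h4 := (hd hlt).le
    rw [Real.dist_eq] at h4
    linarith
  · have h3 : 4 ≤ 4 / δ ^ 2 * dist q q' ^ 2 := by
      rw [div_mul_eq_mul_div, le_div_iff₀ (by positivity)]
      gcongr
    have h4 := abs_sub (f q) (f q')
    linarith [h2 q, h2 q']

/-- Truncation: a bounded variable `X` inherits moment bounds from an `L¹`-close variable `S`. -/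
lemma integral_pow_le_add {Ω : Type*} [MeasurableSpace Ω] {P : Measure Ω} [IsFiniteMeasure P]
    {X S : Ω → ℝ} (mX : Measurable X) (hX : ∀ ω, |X ω| ≤ 2) (p : ℕ)
    (hS : Integrable (fun ω ↦ S ω ^ (2 * p)) P) (hXS : Integrable (fun ω ↦ |S ω - X ω|) P) :
    Integrable (fun ω ↦ X ω ^ (2 * p)) P ∧
    ∫ ω, X ω ^ (2 * p) ∂P ≤ ∫ ω, S ω ^ (2 * p) ∂P
      + (2 * p) * 2 ^ (2 * p - 1) * ∫ ω, |S ω - X ω| ∂P := by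
  have hI : Integrable (fun ω ↦ X ω ^ (2 * p)) P :=
    (integrable_const ((2 : ℝ) ^ (2 * p))).mono' (mX.pow_const _).aestronglyMeasurable
      (.of_forall fun ω ↦ by
        rw [norm_pow]
        exact pow_le_pow_left₀ (norm_nonneg _) (hX ω) _)
  have hI2 := hXS.const_mul ((2 * p) * 2 ^ (2 * p - 1))
  refine ⟨hI, ?_⟩
  rw [← integral_const_mul, ← integral_add hS hI2]
  refine integral_mono hI (hS.add hI2) fun ω ↦ ?_
  change X ω ^ (2 * p) ≤ S ω ^ (2 * p) + (2 * p) * 2 ^ (2 * p - 1) * |S ω - X ω|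
  rw [← (even_two_mul p).pow_abs (X ω), ← (even_two_mul p).pow_abs (S ω)]
  rcases le_total |X ω| |S ω| with h | h
  · have : |X ω| ^ (2 * p) ≤ |S ω| ^ (2 * p) := pow_le_pow_left₀ (abs_nonneg _) h _
    have : 0 ≤ (2 * p) * 2 ^ (2 * p - 1) * |S ω - X ω| := by positivity
    linarith
  · have h1 := abs_pow_sub_pow_le |X ω| |S ω| (2 * p)
    rw [abs_abs, abs_abs, max_eq_left h] at h1
    have h2 : |(|X ω| - |S ω|)| ≤ |S ω - X ω| := by
      rw [abs_sub_comm (S ω)]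
      exact abs_abs_sub_abs_le _ _
    have h3 : |(|X ω| - |S ω|)| * (2 * p : ℕ) * |X ω| ^ (2 * p - 1)
        ≤ |S ω - X ω| * (2 * p : ℕ) * 2 ^ (2 * p - 1) := by
      gcongr
      exact hX ω
    push_cast at h1 h3
    linarith [le_abs_self (|X ω| ^ (2 * p) - |S ω| ^ (2 * p))]

variable {E : Type*} [NormedAddCommGroup E] [InnerProductSpace ℝ E]

/-- The integral of `g t` over the segment from `z` to `z + r • e`. -/
noncomputable def segmentIntegral (g : ℝ × E → ℝ) (r : ℝ) (e : E) (t : ℝ) (z : E) : ℝ :=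
  ∫ u in (0 : ℝ)..r, g (t, z + u • e)

lemma continuous_segmentIntegral {g : ℝ × E → ℝ} (hg : Continuous g) (r : ℝ) (e : E) (t : ℝ) :
    Continuous (segmentIntegral g r e t) :=
  intervalIntegral.continuous_parametric_intervalIntegral_of_continuous' (by fun_prop) _ _

lemma abs_segmentIntegral_le {g : ℝ × E → ℝ} (hg1 : ∀ q, |g q| ≤ 1) {r : ℝ} (hr : 0 ≤ r) (e : E)
    (t : ℝ) (z : E) : |segmentIntegral g r e t z| ≤ r := by
  have := intervalIntegral.norm_integral_le_of_norm_le_const (f := fun u ↦ g (t, z + u • e))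
    (C := 1) (a := 0) (b := r) fun u _ ↦ hg1 _
  rwa [sub_zero, abs_of_nonneg hr, one_mul] at this

/-- The derivative of `segmentIntegral g r e t` along `e` is `g (t, · + r • e) - g (t, ·)`, in
integrated form. -/
lemma segmentIntegral_add_sub {g : ℝ × E → ℝ} (hg : Continuous g) (r : ℝ) (e : E) (t : ℝ) (z : E)
    (b : ℝ) : segmentIntegral g r e t (z + b • e) - segmentIntegral g r e t z
      = ∫ u in (0 : ℝ)..b, (g (t, z + u • e + r • e) - g (t, z + u • e)) := by
  let G : ℝ → ℝ := fun u ↦ g (t, z + u • e)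
  have hG : Continuous G := by fun_prop
  have hI (a c : ℝ) : IntervalIntegrable G volume a c := hG.intervalIntegrable a c
  have h1 : segmentIntegral g r e t (z + b • e) = ∫ u in b..(b + r), G u := by
    rw [segmentIntegral]
    have := intervalIntegral.integral_comp_add_left G b (a := 0) (b := r)
    rw [add_zero] at this
    rw [← this]
    simp only [G, add_smul, add_assoc]
  have h2 : ∫ u in (0 : ℝ)..b, g (t, z + u • e + r • e) = ∫ u in r..(b + r), G u := by
    have := intervalIntegral.integral_comp_add_right G r (a := 0) (b := b)
    rw [zero_add] at this
    rw [← this]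
    simp only [G, add_smul, add_assoc]
  rw [intervalIntegral.integral_sub
    ((by fun_prop : Continuous fun u : ℝ ↦ g (t, z + u • e + r • e)).intervalIntegrable _ _)
    (hI _ _), h1, h2]
  have h3 := intervalIntegral.integral_add_adjacent_intervals (hI 0 b) (hI b (b + r))
  have h4 := intervalIntegral.integral_add_adjacent_intervals (hI 0 r) (hI r (b + r))
  change _ - ∫ u in (0 : ℝ)..r, G u = _ - ∫ u in (0 : ℝ)..b, G u
  linarith

variable [MeasurableSpace E] [FiniteDimensional ℝ E] [BorelSpace E]
  {Ω : Type*} [MeasurableSpace Ω] {P : Measure Ω} {W : ℝ≥0 → Ω → E}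

/-- The moment bound for continuous compactly supported `g`: apply the bound for discretised
covariations to the primitive of `g (t, · + x) - g (t, ·)` along `x`, which is at most `‖x‖`. -/
lemma IsRegularBrownian.integral_pow_le_of_continuous (hW : IsRegularBrownian W P)
    {g : ℝ × E → ℝ} (hg : Continuous g) (hgc : HasCompactSupport g) (hg1 : ∀ q, |g q| ≤ 1)
    {x : E} (hx : x ≠ 0) {m : ℕ} (hm : 0 < m) :
    ∫ ω, (∫ t in (0 : ℝ)..1,
        (g (t, W t.toNNReal ω + x) - g (t, W t.toNNReal ω))) ^ (2 * m) ∂P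
      ≤ (576 * ‖x‖ ^ 2) ^ m * m ! := by
  have := hW.isProbabilityMeasure
  let r : ℝ≥0 := ‖x‖₊
  have hr : 0 < r := nnnorm_pos.2 hx
  have hr' : (0 : ℝ) < r := hr
  let e : E := (r : ℝ)⁻¹ • x
  have he : ‖e‖ = 1 := norm_smul_inv_norm hx
  have hre : (r : ℝ) • e = x := smul_inv_smul₀ hr'.ne' x
  let h : ℝ × E → ℝ := fun q ↦ g (q.1, q.2 + x) - g q
  have hh : Continuous h := by fun_prop
  have hh2 (q : ℝ × E) : |h q| ≤ 2 := by
    have := abs_sub (g (q.1, q.2 + x)) (g q)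
    have h1 := hg1 (q.1, q.2 + x)
    have h2 := hg1 q
    simp only [h]
    linarith
  have hhu : UniformContinuous h := by
    have hgu := hgc.uniformContinuous_of_continuous hg
    exact (hgu.comp (uniformContinuous_fst.prodMk
      (uniformContinuous_snd.add uniformContinuous_const))).sub hgu
  let J : ℕ → Ω → ℝ := fun n ω ↦ ∑ k ∈ Finset.range n, h ((k / n : ℝ), W (k / n) ω) * (1 / n)
  have mJ (n : ℕ) : Measurable (J n) := Finset.measurable_fun_sum _ fun k _ ↦
    (hh.measurable.comp (measurable_const.prodMk (hW.measurable _))).mul_const _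
  have hJ2 (n : ℕ) (ω : Ω) : |J n ω| ≤ 2 := by
    refine (Finset.abs_sum_le_sum_abs _ _).trans ?_
    calc _ ≤ ∑ k ∈ Finset.range n, 2 * (1 / (n : ℝ)) := by
          refine Finset.sum_le_sum fun k _ ↦ ?_
          rw [abs_mul, abs_of_nonneg (by positivity : 0 ≤ 1 / (n : ℝ))]
          gcongr
          exact hh2 _
      _ ≤ 2 := by
          rw [Finset.sum_const, Finset.card_range, nsmul_eq_mul]
          rcases Nat.eq_zero_or_pos n with rfl | hn
          · simp
          · field_simp
            rfl
  have hlim (ω : Ω) : Tendsto (fun n ↦ J n ω) atTop (𝓝 (∫ t in (0 : ℝ)..1,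
      (g (t, W t.toNNReal ω + x) - g (t, W t.toNNReal ω)))) := by
    have hc : Continuous fun t : ℝ ↦ h (t, W t.toNNReal ω) :=
      hh.comp (continuous_id.prodMk ((hW.continuous ω).comp continuous_real_toNNReal))
    refine (tendsto_riemann_sum hc).congr fun n ↦ Finset.sum_congr rfl fun k _ ↦ ?_
    have : ((k : ℝ) / n).toNNReal = (k : ℝ≥0) / n := by
      rw [Real.toNNReal_div (by positivity)]
      simp
    rw [this]
  let F : ℕ → ℕ → E → ℝ := fun n k z ↦ segmentIntegral g r e (k / n) z
  have mF (n k : ℕ) : Measurable (F n k) := (continuous_segmentIntegral hg r e _).measurable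
  have hF (n k : ℕ) (z : E) : |F n k z| ≤ r := abs_segmentIntegral_le hg1 hr'.le e _ z
  let H : ℕ → ℕ → E → ℝ := fun n k z ↦ h (k / n, z)
  have mH (n k : ℕ) : Measurable (H n k) := hh.measurable.comp measurable_prodMk_left
  have hFH {ε L : ℝ} (hL : 0 ≤ L) (hεL : ∀ q q', |h q - h q'| ≤ ε + L * dist q q' ^ 2)
      (n k : ℕ) (z : E) (b : ℝ) :
      |F n k (z + b • e) - F n k z - b * H n k z| ≤ |b| * (ε + L * b ^ 2) := by
    simp only [F, H]
    rw [segmentIntegral_add_sub hg, hre]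
    have h1 : b * h (k / n, z) = ∫ _ in (0 : ℝ)..b, h (k / n, z) := by simp
    have hc : Continuous fun u : ℝ ↦ h (k / n, z + u • e) := by fun_prop
    have h2 : (∫ u in (0 : ℝ)..b, (g (k / n, z + u • e + x) - g (k / n, z + u • e)))
        - b * h (k / n, z) = ∫ u in (0 : ℝ)..b, (h (k / n, z + u • e) - h (k / n, z)) := by
      rw [h1, intervalIntegral.integral_sub (hc.intervalIntegrable _ _) intervalIntegrable_const]
    rw [h2]
    have h3 := intervalIntegral.norm_integral_le_of_norm_le_const
      (f := fun u ↦ h (k / n, z + u • e) - h (k / n, z)) (C := ε + L * b ^ 2) (a := 0) (b := b)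
      fun u hu ↦ by
        refine (hεL _ _).trans ?_
        have hub : |u| ≤ |b| := by
          rcases Set.mem_uIoc.1 hu with hu | hu
          · rw [abs_of_pos hu.1, abs_of_pos (hu.1.trans_le hu.2)]
            exact hu.2
          · rw [abs_of_nonpos hu.2, abs_of_nonpos (hu.1.le.trans hu.2)]
            linarith [hu.1]
        have hd : dist ((k / n : ℝ), z + u • e) ((k / n : ℝ), z) = |u| := by
          rw [Prod.dist_eq, dist_self, dist_eq_norm, add_sub_cancel_left, norm_smul, he, mul_one]
          simp
        rw [hd, sq_abs]
        have := sq_le_sq.2 hub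
        gcongr
    rwa [sub_zero, mul_comm, Real.norm_eq_abs] at h3
  let A : ℕ → ℝ := fun n ↦ ∫ ω, |gridCovariation W e n (F n) ω - J n ω| ∂P
  have hA (n : ℕ) (hn : 0 < n) :
      Integrable (fun ω ↦ |gridCovariation W e n (F n) ω - J n ω|) P := by
    obtain ⟨L, hL, hεL⟩ := hhu.exists_abs_sub_le hh2 one_pos
    exact (hW.integral_abs_gridCovariation_sub_le he hn (mF n) (mH n) (fun k z ↦ hh2 _) one_pos
      (hFH hL hεL n) hL).1
  have hA0 : Tendsto A atTop (𝓝 0) := by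
    rw [Metric.tendsto_atTop]
    intro ε hε
    obtain ⟨L, hL, hεL⟩ := hhu.exists_abs_sub_le hh2 (by positivity : 0 < ε / 4)
    have ht : Tendsto (fun n : ℕ ↦ (512 * L + 4104 / (ε / 4)) * (1 / (n : ℝ))) atTop (𝓝 0) := by
      simpa using (tendsto_one_div_atTop_nhds_zero_nat (𝕜 := ℝ)).const_mul
        (512 * L + 4104 / (ε / 4))
    obtain ⟨N, hN⟩ := Metric.tendsto_atTop.1 ht (ε / 2) (half_pos hε)
    refine ⟨max N 1, fun n hn ↦ ?_⟩
    have hn0 : 0 < n := (le_max_right N 1).trans hn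
    have h1 := (hW.integral_abs_gridCovariation_sub_le he hn0 (mF n) (mH n) (fun k z ↦ hh2 _)
      (by positivity : 0 < ε / 4) (hFH hL hεL n) hL).2
    have h2 := hN n ((le_max_left N 1).trans hn)
    rw [Real.dist_eq, sub_zero] at h2 ⊢
    have h3 : 0 ≤ A n := integral_nonneg fun ω ↦ abs_nonneg _
    rw [abs_of_nonneg h3]
    change A n ≤ _ at h1
    linarith [le_abs_self ((512 * L + 4104 / (ε / 4)) * (1 / (n : ℝ)))]
  have hbound (n : ℕ) (hn : 0 < n) : ∫ ω, J n ω ^ (2 * m) ∂P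
      ≤ (576 * ‖x‖ ^ 2) ^ m * m ! + (2 * m) * 2 ^ (2 * m - 1) * A n := by
    have h1 := hW.integral_gridCovariation_pow_le he hn hr (mF n) (hF n) hm
    exact (integral_pow_le_add (mJ n) (hJ2 n) m h1.1 (hA n hn)).2.trans
      (add_le_add h1.2 le_rfl)
  have hconv : Tendsto (fun n ↦ ∫ ω, J n ω ^ (2 * m) ∂P) atTop (𝓝 (∫ ω, (∫ t in (0 : ℝ)..1,
      (g (t, W t.toNNReal ω + x) - g (t, W t.toNNReal ω))) ^ (2 * m) ∂P)) := by
    refine tendsto_integral_of_dominated_convergence (fun _ ↦ (2 : ℝ) ^ (2 * m))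
      (fun n ↦ ((mJ n).pow_const _).aestronglyMeasurable) (integrable_const _)
      (fun n ↦ .of_forall fun ω ↦ ?_) (.of_forall fun ω ↦ (hlim ω).pow _)
    rw [norm_pow]
    exact pow_le_pow_left₀ (norm_nonneg _) (hJ2 n ω) _
  refine le_of_tendsto_of_tendsto hconv (g := fun n ↦ (576 * ‖x‖ ^ 2) ^ m * m !
    + (2 * m) * 2 ^ (2 * m - 1) * A n) ?_ ((eventually_gt_atTop 0).mono hbound)
  simpa using (hA0.const_mul ((2 * m) * 2 ^ (2 * m - 1) : ℝ)).const_add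
    ((576 * ‖x‖ ^ 2) ^ m * (m ! : ℝ))

end ContinuousIntegrand

/-! ### Borel integrands -/

section BorelIntegrand

variable {E : Type*} [NormedAddCommGroup E] [InnerProductSpace ℝ E] [MeasurableSpace E]
  [FiniteDimensional ℝ E] [BorelSpace E]
  {Ω : Type*} [MeasurableSpace Ω] {P : Measure Ω} {W : ℝ≥0 → Ω → E}

namespace IsRegularBrownian

/-- The moment bound for Borel `g`, by approximation of `g` by continuous compactly supported functions in
`L¹` of the occupation measure of `(t, W t)` and `(t, W t + x)`. -/
lemma integral_pow_le (hW : IsRegularBrownian W P) {g : ℝ × E → ℝ} (hg : Measurable g)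
    (hg1 : ∀ q, |g q| ≤ 1) {x : E} (hx : x ≠ 0) {m : ℕ} (hm : 0 < m) :
    (∀ ω, IntervalIntegrable
      (fun t ↦ g (t, W t.toNNReal ω + x) - g (t, W t.toNNReal ω)) volume 0 1) ∧
    Integrable (fun ω ↦ (∫ t in (0 : ℝ)..1,
        (g (t, W t.toNNReal ω + x) - g (t, W t.toNNReal ω))) ^ (2 * m)) P ∧
    ∫ ω, (∫ t in (0 : ℝ)..1,
        (g (t, W t.toNNReal ω + x) - g (t, W t.toNNReal ω))) ^ (2 * m) ∂P
      ≤ (576 * ‖x‖ ^ 2) ^ m * m ! := by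
  have := hW.isProbabilityMeasure
  let κ : Measure ℝ := volume.restrict (Set.Ioc 0 1)
  have hκ : IsProbabilityMeasure κ := ⟨by simp [κ]⟩
  let Φ : Ω × ℝ → ℝ × E := fun q ↦ (q.2, W q.2.toNNReal q.1)
  let Ψ : Ω × ℝ → ℝ × E := fun q ↦ (q.2, W q.2.toNNReal q.1 + x)
  have mW : Measurable fun q : Ω × ℝ ↦ W q.2.toNNReal q.1 :=
    (measurable_uncurry_of_continuous_of_measurable (u := W) hW.continuous hW.measurable).comp
      (measurable_snd.real_toNNReal.prodMk measurable_fst)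
  have mΦ : Measurable Φ := measurable_snd.prodMk mW
  have mΨ : Measurable Ψ := measurable_snd.prodMk (mW.add_const x)
  -- the integrand and its integral, for an arbitrary function in place of `g`
  let D : (ℝ × E → ℝ) → Ω × ℝ → ℝ := fun f q ↦ f (Ψ q) - f (Φ q)
  let I : (ℝ × E → ℝ) → Ω → ℝ := fun f ω ↦ ∫ t, D f (ω, t) ∂κ
  have hI (f : ℝ × E → ℝ) (ω : Ω) : ∫ t in (0 : ℝ)..1,
      (f (t, W t.toNNReal ω + x) - f (t, W t.toNNReal ω)) = I f ω :=
    intervalIntegral.integral_of_le zero_le_one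
  have mD {f : ℝ × E → ℝ} (hf : Measurable f) : Measurable (D f) :=
    (hf.comp mΨ).sub (hf.comp mΦ)
  have hD2 {f : ℝ × E → ℝ} (hf : ∀ q, |f q| ≤ 1) (q : Ω × ℝ) : ‖D f q‖ ≤ 2 := by
    have := abs_sub (f (Ψ q)) (f (Φ q))
    rw [Real.norm_eq_abs]
    linarith [hf (Ψ q), hf (Φ q)]
  have iD {f : ℝ × E → ℝ} (mf : Measurable f) (hf : ∀ q, |f q| ≤ 1) (ω : Ω) :
      Integrable (fun t ↦ D f (ω, t)) κ :=
    (integrable_const (2 : ℝ)).mono' ((mD mf).comp measurable_prodMk_left).aestronglyMeasurable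
      (.of_forall fun t ↦ hD2 hf _)
  have mI {f : ℝ × E → ℝ} (mf : Measurable f) : Measurable (I f) :=
    (mD mf).stronglyMeasurable.integral_prod_right'.measurable
  have hI2 {f : ℝ × E → ℝ} (hf : ∀ q, |f q| ≤ 1) (ω : Ω) : |I f ω| ≤ 2 := by
    have := norm_integral_le_of_norm_le_const (μ := κ) (f := fun t ↦ D f (ω, t)) (C := 2)
      (.of_forall fun t ↦ hD2 hf _)
    simpa using this
  simp_rw [hI]
  have hIm : Integrable (fun ω ↦ I g ω ^ (2 * m)) P :=
    (integrable_const ((2 : ℝ) ^ (2 * m))).mono' ((mI hg).pow_const _).aestronglyMeasurable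
      (.of_forall fun ω ↦ by
        rw [norm_pow]
        exact pow_le_pow_left₀ (norm_nonneg _) (hI2 hg1 ω) _)
  refine ⟨fun ω ↦ (intervalIntegrable_iff_integrableOn_Ioc_of_le zero_le_one).2 (iD hg hg1 ω),
    hIm, ?_⟩
  let μ : Measure (ℝ × E) := (P.prod κ).map Φ + (P.prod κ).map Ψ
  have : IsFiniteMeasure ((P.prod κ).map Φ) := Measure.isFiniteMeasure_map _ _
  have : IsFiniteMeasure ((P.prod κ).map Ψ) := Measure.isFiniteMeasure_map _ _
  have hgμ : Integrable g μ := (integrable_const (1 : ℝ)).mono' hg.aestronglyMeasurable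
    (.of_forall hg1)
  have key (ε : ℝ) (hε : 0 < ε) : ∫ ω, I g ω ^ (2 * m) ∂P
      ≤ (576 * ‖x‖ ^ 2) ^ m * m ! + (2 * m) * 2 ^ (2 * m - 1) * ε := by
    obtain ⟨f₀, hf₀c, hf₀, hf₀cont, hf₀i⟩ := hgμ.exists_hasCompactSupport_integral_sub_le hε
    let f : ℝ × E → ℝ := fun q ↦ max (-1) (min 1 (f₀ q))
    have hf : Continuous f := by fun_prop
    have hfc : HasCompactSupport f :=
      hf₀c.comp_left (g := fun y : ℝ ↦ max (-1) (min 1 y)) (by norm_num)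
    have hf1 (q : ℝ × E) : |f q| ≤ 1 := abs_le.2 ⟨le_max_left _ _, max_le (by norm_num)
      (min_le_left _ _)⟩
    have hgf (q : ℝ × E) : |f q - g q| ≤ ‖g q - f₀ q‖ := by
      have h1 := abs_le.1 (hg1 q)
      rw [abs_sub_comm, Real.norm_eq_abs]
      have h2 : g q = max (-1) (min 1 (g q)) := by
        rw [min_eq_right h1.2, max_eq_right h1.1]
      calc |g q - f q| = |max (-1) (min 1 (g q)) - max (-1) (min 1 (f₀ q))| := by rw [← h2]
        _ ≤ |min 1 (g q) - min 1 (f₀ q)| := by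
          simpa using abs_max_sub_max_le_max (-1) (min 1 (g q)) (-1) (min 1 (f₀ q))
        _ ≤ _ := by simpa using abs_min_sub_min_le_max 1 (g q) 1 (f₀ q)
    have hfg : Measurable fun q ↦ |f q - g q| := (hf.measurable.sub hg).abs
    have hfg2 (q : ℝ × E) : ‖(|f q - g q|)‖ ≤ 2 := by
      rw [Real.norm_eq_abs, abs_abs]
      have := abs_sub (f q) (g q)
      linarith [hf1 q, hg1 q]
    have iΦ : Integrable (fun q ↦ |f (Φ q) - g (Φ q)|) (P.prod κ) :=
      (integrable_const (2 : ℝ)).mono' (hfg.comp mΦ).aestronglyMeasurable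
        (.of_forall fun q ↦ hfg2 _)
    have iΨ : Integrable (fun q ↦ |f (Ψ q) - g (Ψ q)|) (P.prod κ) :=
      (integrable_const (2 : ℝ)).mono' (hfg.comp mΨ).aestronglyMeasurable
        (.of_forall fun q ↦ hfg2 _)
    have iΨΦ : Integrable (fun q ↦ |f (Ψ q) - g (Ψ q)| + |f (Φ q) - g (Φ q)|) (P.prod κ) :=
      iΨ.add iΦ
    have hfgμ (ν : Measure (ℝ × E)) [IsFiniteMeasure ν] : Integrable (fun q ↦ |f q - g q|) ν :=
      (integrable_const (2 : ℝ)).mono' hfg.aestronglyMeasurable (.of_forall hfg2)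
    have hμ : ∫ q, (|f (Ψ q) - g (Ψ q)| + |f (Φ q) - g (Φ q)|) ∂(P.prod κ) ≤ ε := by
      rw [integral_add iΨ iΦ, ← integral_map mΨ.aemeasurable (f := fun q ↦ |f q - g q|)
        hfg.aestronglyMeasurable, ← integral_map mΦ.aemeasurable (f := fun q ↦ |f q - g q|)
        hfg.aestronglyMeasurable, add_comm, ← integral_add_measure (hfgμ _) (hfgμ _)]
      exact (integral_mono (hfgμ μ) (hgμ.sub hf₀i).norm hgf).trans hf₀
    have hpt (ω : Ω) : |I f ω - I g ω|
        ≤ ∫ t, (|f (Ψ (ω, t)) - g (Ψ (ω, t))| + |f (Φ (ω, t)) - g (Φ (ω, t))|) ∂κ := by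
      simp only [I]
      rw [← integral_sub (iD hf.measurable hf1 ω) (iD hg hg1 ω)]
      refine (norm_integral_le_integral_norm _).trans (integral_mono
        ((iD hf.measurable hf1 ω).sub (iD hg hg1 ω)).norm ?_ fun t ↦ ?_)
      · refine (integrable_const (4 : ℝ)).mono' (((hfg.comp mΨ).add (hfg.comp mΦ)).comp
          measurable_prodMk_left).aestronglyMeasurable (.of_forall fun t ↦ ?_)
        refine (norm_add_le _ _).trans ?_
        linarith [hfg2 (Ψ (ω, t)), hfg2 (Φ (ω, t))]
      · have : f (Ψ (ω, t)) - f (Φ (ω, t)) - (g (Ψ (ω, t)) - g (Φ (ω, t)))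
          = (f (Ψ (ω, t)) - g (Ψ (ω, t))) - (f (Φ (ω, t)) - g (Φ (ω, t))) := by ring
        change |f (Ψ (ω, t)) - f (Φ (ω, t)) - (g (Ψ (ω, t)) - g (Φ (ω, t)))| ≤ _
        rw [this]
        exact abs_sub _ _
    have hIfg : Integrable (fun ω ↦ |I f ω - I g ω|) P :=
      (integrable_const (4 : ℝ)).mono' ((mI hf.measurable).sub (mI hg)).abs.aestronglyMeasurable
        (.of_forall fun ω ↦ by
          rw [Real.norm_eq_abs, abs_abs]
          have := abs_sub (I f ω) (I g ω)
          linarith [hI2 hf1 ω, hI2 hg1 ω])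
    have hE : ∫ ω, |I f ω - I g ω| ∂P ≤ ε := by
      rw [integral_prod _ iΨΦ] at hμ
      exact (integral_mono hIfg iΨΦ.integral_prod_left hpt).trans hμ
    have hfm : Integrable (fun ω ↦ I f ω ^ (2 * m)) P :=
      (integrable_const ((2 : ℝ) ^ (2 * m))).mono'
        ((mI hf.measurable).pow_const _).aestronglyMeasurable
        (.of_forall fun ω ↦ by
          rw [norm_pow]
          exact pow_le_pow_left₀ (norm_nonneg _) (hI2 hf1 ω) _)
    refine (integral_pow_le_add (mI hg) (hI2 hg1) m hfm hIfg).2.trans (add_le_add ?_ ?_)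
    · have := hW.integral_pow_le_of_continuous hf hfc hf1 hx hm
      simp_rw [hI] at this
      exact this
    · exact mul_le_mul_of_nonneg_left hE (by positivity)
  have hpos : 0 < (2 * m : ℝ) * 2 ^ (2 * m - 1) := by positivity
  refine le_of_forall_pos_le_add fun δ hδ ↦ ?_
  have := key (δ / ((2 * m : ℝ) * 2 ^ (2 * m - 1))) (div_pos hδ hpos)
  rwa [mul_div_cancel₀ _ hpos.ne'] at this

end IsRegularBrownian

end BorelIntegrand

/-! ### From coordinates to a regular version -/

section Coordinates

open scoped RealInnerProductSpace Topology
open Filter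

variable {d : ℕ} {Ω : Type*} [MeasurableSpace Ω] {P : Measure Ω}
  {W : ℝ≥0 → Ω → EuclideanSpace ℝ (Fin d)}

lemma inner_eq_sum_mul (z v : EuclideanSpace ℝ (Fin d)) : ⟪z, v⟫ = ∑ i, v i * z i := by
  simp [PiLp.inner_apply]

namespace IsStandardBrownianMotion

lemma aemeasurable (hW : IsStandardBrownianMotion W P) (t : ℝ≥0) : AEMeasurable (W t) P := by
  have h : AEMeasurable (fun ω i ↦ W t ω i) P :=
    aemeasurable_pi_lambda _ fun i ↦ (hW.isBrownianReal_coord i).aemeasurable t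
  exact (MeasurableEquiv.toLp 2 (Fin d → ℝ)).measurable.comp_aemeasurable h

lemma ae_continuous (hW : IsStandardBrownianMotion W P) : ∀ᵐ ω ∂P, Continuous (W · ω) := by
  have h := ae_all_iff.2 fun i ↦ (hW.isBrownianReal_coord i).cont
  filter_upwards [h] with ω hω
  exact (PiLp.continuous_toLp 2 _).comp (continuous_pi hω)

lemma isGaussianProcess_coord [IsProbabilityMeasure P] (hW : IsStandardBrownianMotion W P) :
    IsGaussianProcess (fun (q : ℝ≥0 × Fin d) ω ↦ W q.1 ω q.2) P where
  hasGaussianLaw I := by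
    classical
    let J : Finset ℝ≥0 := I.image Prod.fst
    have h1 (i : Fin d) : HasGaussianLaw (fun ω (t : J) ↦ W t ω i) P :=
      (IsPreBrownianReal.isGaussianProcess
        (hW.isBrownianReal_coord i).toIsPreBrownianReal).hasGaussianLaw J
    have h2 : iIndepFun (fun (i : Fin d) ω (t : J) ↦ W t ω i) P :=
      hW.iIndepFun_coord.comp (fun _ f (t : J) ↦ f t)
        fun _ ↦ measurable_pi_lambda _ fun t ↦ measurable_pi_apply _
    let L : (Fin d → J → ℝ) →L[ℝ] (I → ℝ) :=
      { toFun f q := f q.1.2 ⟨q.1.1, Finset.mem_image_of_mem _ q.2⟩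
        map_add' _ _ := rfl
        map_smul' _ _ := rfl }
    exact (h2.hasGaussianLaw h1).map L

lemma memLp_coord (hW : IsStandardBrownianMotion W P) (t : ℝ≥0) (i : Fin d) :
    MemLp (fun ω ↦ W t ω i) 2 P :=
  ((IsPreBrownianReal.isGaussianProcess
    (hW.isBrownianReal_coord i).toIsPreBrownianReal).hasGaussianLaw_eval t).memLp_two

lemma covariance_coord [IsProbabilityMeasure P] (hW : IsStandardBrownianMotion W P) (s t : ℝ≥0)
    (i j : Fin d) : cov[fun ω ↦ W s ω i, fun ω ↦ W t ω j; P]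
      = if i = j then min (s : ℝ) t else 0 := by
  split_ifs with h
  · subst h
    exact_mod_cast (hW.isBrownianReal_coord i).covariance_fun_eval s t
  · exact ((hW.iIndepFun_coord.indepFun h).comp (measurable_pi_apply s)
      (measurable_pi_apply t)).covariance_eq_zero (hW.memLp_coord s i) (hW.memLp_coord t j)

/-- Restricting to a set of full measure makes a standard Brownian motion regular. -/
lemma exists_isRegularBrownian [IsProbabilityMeasure P] (hW : IsStandardBrownianMotion W P) :
    ∃ V : ℝ≥0 → Ω → EuclideanSpace ℝ (Fin d), IsRegularBrownian V P ∧
      ∀ᵐ ω ∂P, ∀ t, V t ω = W t ω := by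
  classical
  let q : ℕ → ℝ≥0 := TopologicalSpace.denseSeq ℝ≥0
  have hq : DenseRange q := TopologicalSpace.denseRange_denseSeq ℝ≥0
  have hA : ∀ᵐ ω ∂P, Continuous (W · ω) ∧ ∀ n, W (q n) ω = (hW.aemeasurable (q n)).mk _ ω :=
    hW.ae_continuous.and (ae_all_iff.2 fun n ↦ (hW.aemeasurable (q n)).ae_eq_mk)
  obtain ⟨A, hAP, hAm, hA⟩ := hA.exists_measurable_mem
  let V : ℝ≥0 → Ω → EuclideanSpace ℝ (Fin d) := fun t ↦ A.indicator (W t)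
  have hVW : ∀ᵐ ω ∂P, ∀ t, V t ω = W t ω := by
    filter_upwards [hAP] with ω hω t
    exact Set.indicator_of_mem hω _
  have hcont (ω : Ω) : Continuous (V · ω) := by
    by_cases hω : ω ∈ A
    · simpa only [V, Set.indicator_of_mem hω] using (hA ω hω).1
    · simpa only [V, Set.indicator_of_notMem hω] using continuous_const
  have hmq (n : ℕ) : Measurable (V (q n)) := by
    have : V (q n) = A.indicator ((hW.aemeasurable (q n)).mk _) :=
      Set.indicator_congr fun ω hω ↦ (hA ω hω).2 n
    rw [this]
    exact (hW.aemeasurable (q n)).measurable_mk.indicator hAm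
  have hmeas (t : ℝ≥0) : Measurable (V t) := by
    obtain ⟨u, hu, hut⟩ := mem_closure_iff_seq_limit.1 (hq t)
    refine measurable_of_tendsto_metrizable (f := fun n ↦ V (u n)) (fun n ↦ ?_)
      (tendsto_pi_nhds.2 fun ω ↦ ((hcont ω).tendsto t).comp hut)
    obtain ⟨k, hk⟩ := hu n
    rw [← hk]
    exact hmq k
  have hVt (t : ℝ≥0) : W t =ᵐ[P] V t := hVW.mono fun ω hω ↦ (hω t).symm
  have hin (t : ℝ≥0) (v : EuclideanSpace ℝ (Fin d)) :
      (fun ω ↦ ⟪W t ω, v⟫) =ᵐ[P] fun ω ↦ ⟪V t ω, v⟫ := by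
    filter_upwards [hVt t] with ω hω
    rw [hω]
  refine ⟨V, ⟨hmeas, hcont, ?_, fun t v ↦ ?_, fun s t u v ↦ ?_⟩, hVW⟩
  · refine IsGaussianProcess.congr (X := fun (p : ℝ≥0 × EuclideanSpace ℝ (Fin d)) ω ↦
      ⟪W p.1 ω, p.2⟫) ?_ fun p ↦ hin p.1 p.2
    refine hW.isGaussianProcess_coord.of_isGaussianProcess fun p ↦
      ⟨Finset.univ.image fun i ↦ (p.1, i), ∑ i, p.2 i • ContinuousLinearMap.proj
        (⟨(p.1, i), Finset.mem_image_of_mem _ (Finset.mem_univ i)⟩ :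
          Finset.univ.image fun i : Fin d ↦ (p.1, i)), fun ω ↦ ?_⟩
    simp [inner_eq_sum_mul]
  · rw [← integral_congr_ae (hin t v)]
    simp_rw [inner_eq_sum_mul]
    rw [integral_finsetSum _ fun i _ ↦ ((hW.memLp_coord t i).integrable one_le_two).const_mul _]
    refine Finset.sum_eq_zero fun i _ ↦ ?_
    rw [integral_const_mul]
    have := (hW.isBrownianReal_coord i).integral_eval t
    simp [this]
  · have hcov : cov[fun ω ↦ ⟪V s ω, u⟫, fun ω ↦ ⟪V t ω, v⟫; P]
        = cov[fun ω ↦ ⟪W s ω, u⟫, fun ω ↦ ⟪W t ω, v⟫; P] := by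
      rw [covariance, covariance, integral_congr_ae (hin s u), integral_congr_ae (hin t v)]
      refine integral_congr_ae ?_
      filter_upwards [hin s u, hin t v] with ω h1 h2
      rw [h1, h2]
    rw [hcov]
    simp_rw [inner_eq_sum_mul]
    rw [covariance_fun_sum_fun_sum (fun i ↦ (hW.memLp_coord s i).const_mul _)
      (fun i ↦ (hW.memLp_coord t i).const_mul _)]
    simp_rw [covariance_const_mul_left, covariance_const_mul_right, hW.covariance_coord]
    simp [Finset.mul_sum, mul_comm, mul_left_comm]

end IsStandardBrownianMotion

end Coordinates

theorem proposition2p1 :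
    ∃ C : ℝ, 0 < C ∧
      ∀ (d : ℕ) (Ω : Type*) [MeasurableSpace Ω] (P : Measure Ω) [IsProbabilityMeasure P]
        (W : ℝ≥0 → Ω → EuclideanSpace ℝ (Fin d)) (_ : IsStandardBrownianMotion W P)
        (g : ℝ × EuclideanSpace ℝ (Fin d) → ℝ)
        (_ : Measurable ((Set.Icc (0 : ℝ) 1 ×ˢ Set.univ).domRestrict g))
        (_ : ∀ s ∈ Set.Icc (0 : ℝ) 1, ∀ z, |g (s, z)| ≤ 1)
        (p : ℕ) (_ : Even p) (_ : 0 < p) (x : EuclideanSpace ℝ (Fin d)),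
        (∀ᵐ ω ∂P, IntervalIntegrable
          (fun t ↦ g (t, W t.toNNReal ω + x) - g (t, W t.toNNReal ω)) volume 0 1) ∧
        Integrable (fun ω ↦
          (∫ t in (0 : ℝ)..1, (g (t, W t.toNNReal ω + x) - g (t, W t.toNNReal ω))) ^ p) P ∧
        ∫ ω, (∫ t in (0 : ℝ)..1,
            (g (t, W t.toNNReal ω + x) - g (t, W t.toNNReal ω))) ^ p ∂P
          ≤ C ^ p * ((p / 2)! : ℝ) * ‖x‖ ^ p := by
  -- `24 ^ 2` is the constant `576` of the moment bound
  refine ⟨24, by norm_num, ?_⟩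
  intro d Ω _ P _ W hW g hg hg1 p hp hp0 x
  obtain ⟨m, rfl⟩ := hp.two_dvd
  have hm : 0 < m := by omega
  rcases eq_or_ne x 0 with rfl | hx
  · simp [hm.ne']
  obtain ⟨V, hV, hVW⟩ := hW.exists_isRegularBrownian
  let s : Set (ℝ × EuclideanSpace ℝ (Fin d)) := Set.Icc (0 : ℝ) 1 ×ˢ Set.univ
  have hs : MeasurableSet s := measurableSet_Icc.prod .univ
  -- only the values of `g` on `[0, 1] × ℝ^d` matter
  let f : ℝ × EuclideanSpace ℝ (Fin d) → ℝ := s.indicator g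
  have hf : Measurable f := measurable_of_restrict_of_restrict_compl hs
    (by
      convert hg using 1
      exact funext fun q ↦ Set.indicator_of_mem q.2 g)
    (by
      convert measurable_const (a := (0 : ℝ)) using 1
      exact funext fun q ↦ Set.indicator_of_notMem q.2 g)
  have hf1 (q : ℝ × EuclideanSpace ℝ (Fin d)) : |f q| ≤ 1 := by
    by_cases hq : q ∈ s
    · simpa only [f, Set.indicator_of_mem hq] using hg1 q.1 hq.1 q.2
    · simp [f, Set.indicator_of_notMem hq]
  have hfg {t : ℝ} (ht : t ∈ Set.Icc (0 : ℝ) 1) (z : EuclideanSpace ℝ (Fin d)) :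
      f (t, z) = g (t, z) := Set.indicator_of_mem (s := s) ⟨ht, trivial⟩ g
  have hint {ω : Ω} (hω : ∀ t, V t ω = W t ω) : Set.EqOn
      (fun t ↦ f (t, V t.toNNReal ω + x) - f (t, V t.toNNReal ω))
      (fun t ↦ g (t, W t.toNNReal ω + x) - g (t, W t.toNNReal ω)) (Set.uIcc 0 1) := by
    intro t ht
    rw [Set.uIcc_of_le zero_le_one] at ht
    simp only [hfg ht, hω]
  have hI : (fun ω ↦ (∫ t in (0 : ℝ)..1,
      (f (t, V t.toNNReal ω + x) - f (t, V t.toNNReal ω))) ^ (2 * m)) =ᵐ[P]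
      fun ω ↦ (∫ t in (0 : ℝ)..1,
        (g (t, W t.toNNReal ω + x) - g (t, W t.toNNReal ω))) ^ (2 * m) := by
    filter_upwards [hVW] with ω hω
    rw [intervalIntegral.integral_congr (hint hω)]
  obtain ⟨h1, h2, h3⟩ := hV.integral_pow_le hf hf1 hx hm
  refine ⟨?_, h2.congr hI, ?_⟩
  · filter_upwards [hVW] with ω hω
    exact (h1 ω).congr ((hint hω).mono Set.uIoc_subset_uIcc)
  · rw [← integral_congr_ae hI]
    refine h3.trans (le_of_eq ?_)
    rw [Nat.mul_div_cancel_left m two_pos, pow_mul, pow_mul, mul_pow]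
    norm_num
    ring
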